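/- Let \(S=[0,1]^2\) be the unit square, let \(d\) be the Euclidean distance, and let \(X_1,X_2,\ldots\) be independent random points, each uniformly distributed in \(S\). Let \(h:\mathbb{R}^2\times\mathbb{R}^2\to\mathbb{R}\) be a measurable function such that (i) there are constants \(c_1,c_2>0\) with \(c_1\,d(x,y)\le h(x,y)=h(y,x)\le c_2\,d(x,y)\) for all \(x,y\in S\); (ii) \(h(au,av)=a\,h(u,v)\) for all \(a>0\) and all \(u,v\in\mathbb{R}^2\); (iii) \(h_0>0\) is a constant with \(h(b+u,b+v)\le h_0\,h(u,v)\) for all \(b,u,v\in\mathbb{R}^2\). Let \(0<\alpha<2\), and let \(TSP_n\) be the minimum, over all spanning cycles \(\mathcal{C}\) of the complete graph on the nodes \(X_1,\ldots,X_n\), of the weight \(W(\mathcal{C})=\sum_{(u,v)\in\mathcal{C}}h(u,v)^{\alpha}\), the sum running over the edges of \(\mathcal{C}\). Then \(\mathbb{E}\,TSP_n\) is well defined and finite for every \(n\), and \[ 0<\liminf_{n}\frac{\mathbb{E}\,TSP_n}{n^{1-\alpha/2}}\le\limsup_{n}\frac{\mathbb{E}\,TSP_n}{n^{1-\alpha/2}}\le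 h_0^{\alpha}\cdot\liminf_{n}\frac{\mathbb{E}\,TSP_n}{n^{1-\alpha/2}}<\infty . \] -/

import Mathlib

/-- The Euclidean plane `ℝ²`. -/
abbrev Plane : Type := EuclideanSpace ℝ (Fin 2)

/-- The closed unit square `S = [0,1]²`. -/
def unitSquare : Set Plane := {x | ∀ i, x i ∈ Set.Icc (0 : ℝ) 1}

/-- Weight of the spanning cycle `(Y₁, …, Yₙ, Y₁)` which visits the nodes `x` in the order
`Y_j = x (σ j)`: the sum of `h ^ α` over the edges `(Y₁, Y₂), …, (Yₙ₋₁, Yₙ), (Yₙ, Y₁)`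
(`finRotate n` is the cyclic successor on `Fin n`). -/
noncomputable def cycleWeight (h : Plane → Plane → ℝ) (α : ℝ) {n : ℕ} (x : Fin n → Plane)
    (σ : Equiv.Perm (Fin n)) : ℝ :=
  ∑ j : Fin n, h (x (σ j)) (x (σ (finRotate n j))) ^ α

/-- The travelling salesman weight of the nodes `x`: the minimum weight of a spanning cycle of
the complete graph on these nodes. -/
noncomputable def tspWeight (h : Plane → Plane → ℝ) (α : ℝ) {n : ℕ} (x : Fin n → Plane) : ℝ :=
  (Finset.univ : Finset (Equiv.Perm (Fin n))).inf' Finset.univ_nonempty (cycleWeight h α x)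

/-- `TSP_n`, the travelling salesman weight of the first `n` random nodes, as a random variable. -/
noncomputable def tspOf {Ω : Type*} (h : Plane → Plane → ℝ) (α : ℝ) (X : ℕ → Ω → Plane) (n : ℕ)
    (ω : Ω) : ℝ :=
  tspWeight h α (fun i : Fin n => X i ω)

/-- The scaled expected weight `E TSP_n / n ^ (1 - α / 2)`, as an extended real number (so that
`liminf` and `limsup` always have their usual meaning). -/
noncomputable def scaledMeanTSP {Ω : Type*} [MeasurableSpace Ω] (P : MeasureTheory.Measure Ω)
    (h : Plane → Plane → ℝ) (α : ℝ) (X : ℕ → Ω → Plane) (n : ℕ) : EReal :=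
  (((∫ ω, tspOf h α X n ω ∂P) / (n : ℝ) ^ (1 - α / 2) : ℝ) : EReal)

/-! Write T_n for the mean weight of n uniform nodes and β = 1 - α/2. Cut the square into m × m
cells. Scaling and translating a cell to the unit square costs a factor (h₀/m)^α, and the optimal
tours of the cells can be joined at cost O(m^(2-α)). The joining needs no triangle inequality: tours
are merged four at a time up a dyadic hierarchy, and since α < 2 the costs of the levels form a
geometric sum dominated by the finest level (`hasTour_grid`, `IsEdgeWeight.tspWeight_cellMap_le`).

Given the cells occupied by the nodes, the positions inside the cells are again independent and
uniform, so T_n is at most (h₀/m)^α times the sum of the means of T_N over the cells, plus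
O(m^(2-α)), with N binomial of mean μ = n/m² (`IsEdgeWeight.meanTsp_le_cells`). A quadratic majorant
T_j ≤ A + B(j - μ)² then bounds the mean of T_N through the variance alone
(`IsEdgeWeight.meanTsp_le_of_quadratic`).

This is used twice. With m of order √n it gives T_n = O(n^β). With a fixed and m chosen so that μ is
slightly larger than a, it gives T_n/n^β ≤ h₀^α T_a/a^β + e(a) for all large n, where e(a) → 0
(`eventually_scaled_le`); limsup in n and then liminf in a give the main inequality. Positivity of
the liminf holds because a typical node has no other node within distance of order n^(-1/2)
(`IsEdgeWeight.le_meanTsp`). -/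

open MeasureTheory

/-! ### Closed tours as lists, and their concatenation. -/

/-- Weight of the path which starts at `a`, visits the list in order and ends at `b`. -/
def pathWeight {ι : Type*} (f : ι → ι → ℝ) : ι → List ι → ι → ℝ
  | a, [], b => f a b
  | a, c :: l, b => f a c + pathWeight f c l b

/-- Weight of the closed tour which visits the list in order. -/
def closedWeight {ι : Type*} (f : ι → ι → ℝ) : List ι → ℝ
  | [] => 0
  | a :: l => pathWeight f a l a

/-- The nodes in `A` can be visited by a closed tour of weight at most `w`. -/
def HasTour {ι : Type*} (f : ι → ι → ℝ) (A : Finset ι) (w : ℝ) : Prop :=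
  ∃ L : List ι, L.Nodup ∧ (∀ i, i ∈ L ↔ i ∈ A) ∧ closedWeight f L ≤ w

section Tours

variable {ι : Type*} {f g : ι → ι → ℝ}

theorem pathWeight_append (a b c : ι) (l l' : List ι) :
    pathWeight f a (l ++ b :: l') c = pathWeight f a l b + pathWeight f b l' c := by
  induction l generalizing a with
  | nil => rfl
  | cons d l ih => simp [pathWeight, ih, add_assoc]

/-- Only the last edge is redirected, from `c` to `b`; nonnegativity discards the old one. This
replaces the triangle inequality, which `h ^ α` need not satisfy. -/
theorem pathWeight_le_add {D : ℝ} (a b c : ι) (l : List ι)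
    (h0 : ∀ x ∈ a :: l, 0 ≤ f x c) (hD : ∀ x ∈ a :: l, f x b ≤ D) :
    pathWeight f a l b ≤ pathWeight f a l c + D := by
  induction l generalizing a with
  | nil =>
    have h1 := h0 a (by simp)
    have h2 := hD a (by simp)
    simp only [pathWeight]; linarith
  | cons d l ih =>
    have := ih d (fun x hx => h0 x (List.mem_cons_of_mem _ hx))
      (fun x hx => hD x (List.mem_cons_of_mem _ hx))
    simp only [pathWeight]; linarith

theorem pathWeight_le_length {D : ℝ} (a b : ι) (l : List ι)
    (hD : ∀ x ∈ a :: l, ∀ y ∈ b :: l, f x y ≤ D) :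
    pathWeight f a l b ≤ (l.length + 1) * D := by
  induction l generalizing a with
  | nil => simpa [pathWeight] using hD a (by simp) b (by simp)
  | cons d l ih =>
    have h1 := ih d (fun x hx y hy => hD x (List.mem_cons_of_mem _ hx) y (by
      simp only [List.mem_cons] at hy ⊢; tauto))
    have h2 := hD a (by simp) d (by simp)
    simp only [pathWeight, List.length_cons]; push_cast; linarith

theorem pathWeight_le_mul {c : ℝ} (a b : ι) (l : List ι)
    (hD : ∀ x ∈ a :: l, ∀ y ∈ b :: l, g x y ≤ c * f x y) :
    pathWeight g a l b ≤ c * pathWeight f a l b := by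
  induction l generalizing a with
  | nil => simpa [pathWeight] using hD a (by simp) b (by simp)
  | cons d l ih =>
    have h1 := ih d (fun x hx y hy => hD x (List.mem_cons_of_mem _ hx) y (by
      simp only [List.mem_cons] at hy ⊢; tauto))
    have h2 := hD a (by simp) d (by simp)
    simp only [pathWeight, mul_add]; linarith

theorem HasTour.mono {A : Finset ι} {w w' : ℝ} (h : HasTour f A w) (hw : w ≤ w') :
    HasTour f A w' := by
  obtain ⟨L, h1, h2, h3⟩ := h
  exact ⟨L, h1, h2, h3.trans hw⟩

theorem hasTour_card_mul {D : ℝ} (A : Finset ι) (hD : ∀ i ∈ A, ∀ j ∈ A, f i j ≤ D) :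
    HasTour f A (A.card * D) := by
  refine ⟨A.toList, A.nodup_toList, fun i => Finset.mem_toList, ?_⟩
  have hm : ∀ i ∈ A.toList, i ∈ A := fun i => Finset.mem_toList.1
  rw [← Finset.length_toList A]
  cases hL : A.toList with
  | nil => simp [closedWeight]
  | cons a l =>
    rw [hL] at hm
    have := pathWeight_le_length (f := f) (D := D) a a l
      (fun x hx y hy => hD x (hm x hx) y (hm y hy))
    simpa [closedWeight] using this

theorem HasTour.le_mul {c w : ℝ} {A : Finset ι} (hc : 0 ≤ c) (h : HasTour f A w)
    (hg : ∀ i ∈ A, ∀ j ∈ A, g i j ≤ c * f i j) : HasTour g A (c * w) := by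
  obtain ⟨L, h1, h2, h3⟩ := h
  refine ⟨L, h1, h2, le_trans ?_ (mul_le_mul_of_nonneg_left h3 hc)⟩
  cases L with
  | nil => simp [closedWeight]
  | cons a l =>
    exact pathWeight_le_mul a a l (fun x hx y hy => hg x ((h2 x).1 hx) y ((h2 y).1 hy))

/-- Concatenating the two lists changes only the two closing edges, each replaced by an edge of
weight at most `D`. -/
theorem HasTour.union [DecidableEq ι] {D w w' : ℝ} {A B : Finset ι} (hA : HasTour f A w)
    (hB : HasTour f B w') (hAB : Disjoint A B) (hD0 : 0 ≤ D)
    (hD : ∀ i ∈ A ∪ B, ∀ j ∈ A ∪ B, 0 ≤ f i j ∧ f i j ≤ D) :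
    HasTour f (A ∪ B) (w + w' + 2 * D) := by
  obtain ⟨L, h1, h2, h3⟩ := hA
  obtain ⟨L', h1', h2', h3'⟩ := hB
  refine ⟨L ++ L', ?_, ?_, ?_⟩
  · refine List.Nodup.append h1 h1' ?_
    intro i hi hi'
    exact Finset.disjoint_left.1 hAB ((h2 i).1 hi) ((h2' i).1 hi')
  · intro i; simp [h2, h2']
  · cases L with
    | nil => simp only [closedWeight, List.nil_append] at *; linarith
    | cons a l =>
      cases L' with
      | nil => simp only [closedWeight, List.append_nil] at *; linarith
      | cons b l' =>
        have ma : ∀ x ∈ a :: l, x ∈ A ∪ B := fun x hx => Finset.mem_union_left _ ((h2 x).1 hx)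
        have mb : ∀ x ∈ b :: l', x ∈ A ∪ B := fun x hx => Finset.mem_union_right _ ((h2' x).1 hx)
        have e1 := pathWeight_le_add (f := f) (D := D) a b a l
          (fun x hx => (hD x (ma x hx) a (ma a (by simp))).1)
          (fun x hx => (hD x (ma x hx) b (mb b (by simp))).2)
        have e2 := pathWeight_le_add (f := f) (D := D) b a b l'
          (fun x hx => (hD x (mb x hx) b (mb b (by simp))).1)
          (fun x hx => (hD x (mb x hx) a (ma a (by simp))).2)
        simp only [closedWeight, List.cons_append, pathWeight_append] at *
        linarith

theorem pathWeight_ofFn {n : ℕ} (s : Fin (n + 1) → ι) (b : ι) :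
    pathWeight f (s 0) (List.ofFn fun j : Fin n => s j.succ) b =
      ∑ j : Fin n, f (s j.castSucc) (s j.succ) + f (s (Fin.last n)) b := by
  induction n with
  | zero => simp [pathWeight]
  | succ n ih =>
    have := ih (fun j => s j.succ)
    rw [List.ofFn_succ, pathWeight, this, Fin.sum_univ_succ]
    simp [add_assoc]

theorem closedWeight_ofFn {n : ℕ} (s : Fin n → ι) :
    closedWeight f (List.ofFn s) = ∑ j : Fin n, f (s j) (s (finRotate n j)) := by
  cases n with
  | zero => simp [closedWeight]
  | succ n =>
    rw [List.ofFn_succ, closedWeight, pathWeight_ofFn, Fin.sum_univ_castSucc]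
    simp

theorem hasTour_tspWeight {h : Plane → Plane → ℝ} {α : ℝ} {k : ℕ} (x : ι → Plane)
    (e : Fin k → ι) (he : Function.Injective e) (A : Finset ι) (hA : ∀ i, i ∈ A ↔ ∃ j, e j = i) :
    HasTour (fun i j => h (x i) (x j) ^ α) A (tspWeight h α (fun j => x (e j))) := by
  obtain ⟨σ, -, hσ⟩ := Finset.exists_mem_eq_inf' (Finset.univ_nonempty)
    (cycleWeight h α (fun j => x (e j)))
  refine ⟨List.ofFn (fun j => e (σ j)), ?_, ?_, ?_⟩
  · rw [List.nodup_ofFn]; exact he.comp σ.injective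
  · intro i
    rw [List.mem_ofFn, hA]
    exact ⟨fun ⟨j, hj⟩ => ⟨_, hj⟩, fun ⟨j, hj⟩ => ⟨σ.symm j, by simpa using hj⟩⟩
  · rw [closedWeight_ofFn, tspWeight, hσ]; rfl

theorem tspWeight_le_of_hasTour {h : Plane → Plane → ℝ} {α : ℝ} {n : ℕ} {x : Fin n → Plane}
    {w : ℝ} (hw : HasTour (fun i j => h (x i) (x j) ^ α) Finset.univ w) :
    tspWeight h α x ≤ w := by
  obtain ⟨L, h1, h2, h3⟩ := hw
  have hlen : L.length = n := by
    classical
    have : L.toFinset = Finset.univ := by ext i; simp [h2]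
    rw [← List.toFinset_card_of_nodup h1, this]; simp
  obtain ⟨s, rfl⟩ : ∃ s : Fin n → Fin n, List.ofFn s = L := by
    have key : ∀ k, L.length = k → ∃ s : Fin k → Fin n, List.ofFn s = L := by
      rintro _ rfl
      exact ⟨L.get, List.ofFn_get L⟩
    exact key n hlen
  let σ : Equiv.Perm (Fin n) :=
    Equiv.ofBijective s (Finite.injective_iff_bijective.1 (List.nodup_ofFn.1 h1))
  refine le_trans (Finset.inf'_le _ (Finset.mem_univ σ)) (le_trans (le_of_eq ?_) h3)
  rw [closedWeight_ofFn]; rfl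

end Tours

/-! ### Joining the tours of the cells along dyadic blocks. -/

section Dyadic

variable {ι : Type*} [Fintype ι] {f : ι → ι → ℝ} {l₁ l₂ : ι → ℕ}

/-- Joining the tours of `4 ^ r` cells, level by level of the dyadic hierarchy. -/
theorem hasTour_dyadic {D : ℕ → ℝ} {κ : ℕ → ℝ} {w : ℕ → ℕ → ℝ} (hD0 : ∀ r, 0 ≤ D r)
    (hD : ∀ r i j, l₁ i / 2 ^ r = l₁ j / 2 ^ r → l₂ i / 2 ^ r = l₂ j / 2 ^ r →
      0 ≤ f i j ∧ f i j ≤ D r)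
    (hκ0 : 0 ≤ κ 0) (hκ : ∀ r, 4 * κ r + 6 * D (r + 1) ≤ κ (r + 1))
    (hw : ∀ a b, HasTour f (Finset.univ.filter fun i => l₁ i = a ∧ l₂ i = b) (w a b))
    (r a b : ℕ) :
    HasTour f (Finset.univ.filter fun i => l₁ i / 2 ^ r = a ∧ l₂ i / 2 ^ r = b)
      (∑ i ∈ Finset.range (2 ^ r), ∑ j ∈ Finset.range (2 ^ r), w (2 ^ r * a + i) (2 ^ r * b + j)
        + κ r) := by
  classical
  induction r generalizing a b with
  | zero => simpa using (hw a b).mono (by linarith : w a b ≤ w a b + κ 0)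
  | succ r ih =>
    have hdiv : ∀ x : ℕ, x / 2 ^ (r + 1) = x / 2 ^ r / 2 := fun x => by
      rw [pow_succ, Nat.div_div_eq_div_mul]
    have hbd : ∀ i j, l₁ i / 2 ^ r / 2 = a ∧ l₂ i / 2 ^ r / 2 = b →
        l₁ j / 2 ^ r / 2 = a ∧ l₂ j / 2 ^ r / 2 = b → 0 ≤ f i j ∧ f i j ≤ D (r + 1) := by
      intro i j hi hj
      apply hD
      · rw [hdiv, hdiv, hi.1, hj.1]
      · rw [hdiv, hdiv, hi.2, hj.2]
    -- Three unions join the four children of a block, each at cost `2 * D (r + 1)`; hence the `6`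
    -- in `hκ`.
    have t1 := (ih (2 * a) (2 * b)).union (ih (2 * a) (2 * b + 1))
      (D := D (r + 1)) (by
        rw [Finset.disjoint_filter]; intro i _ h1 h2; omega) (hD0 _) (by
        intro i hi j hj
        simp only [Finset.mem_union, Finset.mem_filter, Finset.mem_univ, true_and] at hi hj
        exact hbd i j (by omega) (by omega))
    have t2 := t1.union (ih (2 * a + 1) (2 * b))
      (D := D (r + 1)) (by
        rw [← Finset.filter_or, Finset.disjoint_filter]; intro i _ h1 h2; omega) (hD0 _) (by
        intro i hi j hj
        simp only [Finset.mem_union, Finset.mem_filter, Finset.mem_univ, true_and] at hi hj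
        exact hbd i j (by omega) (by omega))
    have t3 := t2.union (ih (2 * a + 1) (2 * b + 1))
      (D := D (r + 1)) (by
        rw [← Finset.filter_or, ← Finset.filter_or, Finset.disjoint_filter]
        intro i _ h1 h2; omega) (hD0 _) (by
        intro i hi j hj
        simp only [Finset.mem_union, Finset.mem_filter, Finset.mem_univ, true_and] at hi hj
        exact hbd i j (by omega) (by omega))
    have hset : (Finset.univ.filter fun i => l₁ i / 2 ^ (r + 1) = a ∧ l₂ i / 2 ^ (r + 1) = b) =
        (Finset.univ.filter fun i => l₁ i / 2 ^ r = 2 * a ∧ l₂ i / 2 ^ r = 2 * b) ∪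
        (Finset.univ.filter fun i => l₁ i / 2 ^ r = 2 * a ∧ l₂ i / 2 ^ r = 2 * b + 1) ∪
        (Finset.univ.filter fun i => l₁ i / 2 ^ r = 2 * a + 1 ∧ l₂ i / 2 ^ r = 2 * b) ∪
        (Finset.univ.filter fun i => l₁ i / 2 ^ r = 2 * a + 1 ∧ l₂ i / 2 ^ r = 2 * b + 1) := by
      ext i
      simp only [Finset.mem_union, Finset.mem_filter, Finset.mem_univ, true_and, hdiv]
      omega
    rw [hset]
    refine t3.mono ?_
    have hp : 2 ^ (r + 1) = 2 ^ r + 2 ^ r := by ring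
    have hs : ∀ g : ℕ → ℝ, ∑ i ∈ Finset.range (2 ^ (r + 1)), g i =
        ∑ i ∈ Finset.range (2 ^ r), g i + ∑ i ∈ Finset.range (2 ^ r), g (2 ^ r + i) := by
      intro g; rw [hp, Finset.sum_range_add]
    simp only [hs, Finset.sum_add_distrib]
    have e : ∀ c i : ℕ, 2 ^ (r + 1) * c + i = 2 ^ r * (2 * c) + i := fun c i => by ring
    have e' : ∀ c i : ℕ, 2 ^ r * (2 * c) + (2 ^ r + i) = 2 ^ r * (2 * c + 1) + i :=
      fun c i => by ring
    simp only [e, e']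
    linarith [hκ r]

/-- Joining the tours in the `m × m` cells of a grid when nodes in a common dyadic block of level
`r` are joined by edges of weight at most `D * 2 ^ (α * r)`. -/
theorem hasTour_grid {α D : ℝ} (hα₂ : α < 2) (hD0 : 0 ≤ D) {w : ℕ → ℕ → ℝ}
    (hD : ∀ r i j, l₁ i / 2 ^ r = l₁ j / 2 ^ r → l₂ i / 2 ^ r = l₂ j / 2 ^ r →
      0 ≤ f i j ∧ f i j ≤ D * ((2 : ℝ) ^ α) ^ r)
    (hw : ∀ a b, HasTour f (Finset.univ.filter fun i => l₁ i = a ∧ l₂ i = b) (w a b))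
    {m : ℕ} (hm : 1 ≤ m) (hl : ∀ i, l₁ i < m ∧ l₂ i < m)
    (hw0 : ∀ a b, ¬ (a < m ∧ b < m) → w a b = 0) :
    HasTour f Finset.univ (∑ a ∈ Finset.range m, ∑ b ∈ Finset.range m, w a b +
      24 * 2 ^ α / (4 - 2 ^ α) * D * (m : ℝ) ^ 2) := by
  set q : ℝ := 2 ^ α with hq
  have hq0 : 0 < q := by positivity
  have hq4 : q < 4 := by
    have : q < (2 : ℝ) ^ (2 : ℝ) := Real.rpow_lt_rpow_of_exponent_lt (by norm_num) hα₂
    norm_num at this; exact this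
  -- With this `K`, the sequence `K * D * (4 ^ r - q ^ r)` starts at 0 and satisfies the recursion
  -- for `κ` with equality. Since `q < 4`, the total cost is of the order of the number of cells.
  set K : ℝ := 6 * q / (4 - q) with hK
  have hKq : K * (4 - q) = 6 * q := by rw [hK]; field_simp [(by linarith : (4 - q) ≠ 0)]
  have hK0 : 0 ≤ K := div_nonneg (by linarith) (by linarith)
  -- Rounding `m` up to a power of two at most quadruples the number of cells, whence 24 = 4 · 6.
  obtain ⟨k, hk1, hk2⟩ : ∃ k : ℕ, m ≤ 2 ^ k ∧ 2 ^ k ≤ 2 * m := by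
    refine ⟨Nat.clog 2 m, Nat.le_pow_clog (by norm_num) m, ?_⟩
    rcases Nat.lt_or_ge 1 m with h | h
    · have := Nat.pow_pred_clog_lt_self (b := 2) (by norm_num) h
      have hc : 0 < Nat.clog 2 m := Nat.clog_pos (by norm_num) h
      obtain ⟨c, hc'⟩ := Nat.exists_eq_succ_of_ne_zero hc.ne'
      rw [hc'] at this ⊢
      simp only [Nat.pred_succ] at this
      rw [pow_succ]; omega
    · have : m = 1 := le_antisymm h hm
      subst this; simp
  have key := hasTour_dyadic (f := f) (l₁ := l₁) (l₂ := l₂) (D := fun r => D * q ^ r)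
    (κ := fun r => K * D * (4 ^ r - q ^ r)) (w := w) (fun r => by positivity) hD (by simp)
    (fun r => by
      have : K * D * (4 ^ (r + 1) - q ^ (r + 1)) - 4 * (K * D * (4 ^ r - q ^ r)) =
          (K * (4 - q)) * D * q ^ r := by ring
      rw [hKq] at this
      have h2 : 6 * (D * q ^ (r + 1)) = 6 * q * D * q ^ r := by ring
      linarith) hw k 0 0
  have hset : (Finset.univ.filter fun i => l₁ i / 2 ^ k = 0 ∧ l₂ i / 2 ^ k = 0) =
      Finset.univ := by
    ext i
    have := hl i
    simp only [Finset.mem_filter, Finset.mem_univ, true_and, iff_true]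
    exact ⟨Nat.div_eq_of_lt (by omega), Nat.div_eq_of_lt (by omega)⟩
  rw [hset] at key
  refine key.mono ?_
  have hsub : Finset.range m ⊆ Finset.range (2 ^ k) := Finset.range_subset_range.2 hk1
  have hsum : ∑ i ∈ Finset.range (2 ^ k), ∑ j ∈ Finset.range (2 ^ k),
      w (2 ^ k * 0 + i) (2 ^ k * 0 + j) = ∑ a ∈ Finset.range m, ∑ b ∈ Finset.range m, w a b := by
    simp only [mul_zero, zero_add]
    rw [← Finset.sum_subset hsub]
    · refine Finset.sum_congr rfl fun a _ => ?_
      rw [← Finset.sum_subset hsub]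
      intro b _ hb
      exact hw0 a b (by rw [Finset.mem_range] at hb; omega)
    · intro a _ ha
      refine Finset.sum_eq_zero fun b _ => hw0 a b (by rw [Finset.mem_range] at ha; omega)
  rw [hsum]
  have h4 : (4 : ℝ) ^ k ≤ 4 * (m : ℝ) ^ 2 := by
    have h : ((2 : ℝ) ^ k) ≤ 2 * m := by exact_mod_cast hk2
    calc (4 : ℝ) ^ k = ((2 : ℝ) ^ k) ^ 2 := by rw [← pow_mul, mul_comm, pow_mul]; norm_num
      _ ≤ (2 * m) ^ 2 := by gcongr
      _ = _ := by ring
  have : K * D * (4 ^ k - q ^ k) ≤ K * D * (4 * (m : ℝ) ^ 2) := by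
    have : (0 : ℝ) ≤ q ^ k := by positivity
    exact mul_le_mul_of_nonneg_left (by linarith) (by positivity)
  have e : 24 * q / (4 - q) * D * (m : ℝ) ^ 2 = K * D * (4 * (m : ℝ) ^ 2) := by rw [hK]; ring
  linarith

end Dyadic

/-! ### Geometry of the grid and subadditivity over its cells. -/

/-- The assumptions on the edge weight function. -/
structure IsEdgeWeight (h : Plane → Plane → ℝ) (c₁ c₂ h₀ : ℝ) : Prop where
  meas : Measurable (Function.uncurry h)
  c₁_pos : 0 < c₁
  c₂_pos : 0 < c₂
  equiv : ∀ x ∈ unitSquare, ∀ y ∈ unitSquare,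
      c₁ * dist x y ≤ h x y ∧ h x y = h y x ∧ h x y ≤ c₂ * dist x y
  scale : ∀ a : ℝ, 0 < a → ∀ u v : Plane, h (a • u) (a • v) = a * h u v
  h₀_pos : 0 < h₀
  trans : ∀ b u v : Plane, h (b + u) (b + v) ≤ h₀ * h u v

/-- The affine map of the unit square onto the cell `Q` of the `m × m` grid. -/
noncomputable def cellMap (m : ℕ) (Q : Fin m × Fin m) (u : Plane) : Plane :=
  (m : ℝ)⁻¹ • (!₂[((Q.1 : ℕ) : ℝ), ((Q.2 : ℕ) : ℝ)] + u)

/-- The nodes with label `Q`. -/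
def cellNodes {n m : ℕ} (l : Fin n → Fin m × Fin m) (Q : Fin m × Fin m) : Finset (Fin n) :=
  Finset.univ.filter fun i => l i = Q

/-- The travelling salesman weight of the nodes with label `Q`. -/
noncomputable def cellTsp (h : Plane → Plane → ℝ) (α : ℝ) {n m : ℕ} (l : Fin n → Fin m × Fin m)
    (Q : Fin m × Fin m) (u : Fin n → Plane) : ℝ :=
  tspWeight h α (fun j => u ((cellNodes l Q).orderEmbOfFin rfl j))

section Geometry

variable {h : Plane → Plane → ℝ} {c₁ c₂ h₀ α : ℝ}

theorem dist_le_two_mul {x y : Plane} {s : ℝ} (h0 : |x 0 - y 0| ≤ s) (h1 : |x 1 - y 1| ≤ s) :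
    dist x y ≤ 2 * s := by
  have hs : 0 ≤ s := (abs_nonneg _).trans h0
  rw [EuclideanSpace.dist_eq, Fin.sum_univ_two, Real.dist_eq, Real.dist_eq]
  apply Real.sqrt_le_iff.2 ⟨by linarith, ?_⟩
  have := pow_le_pow_left₀ (abs_nonneg _) h0 2
  have := pow_le_pow_left₀ (abs_nonneg _) h1 2
  nlinarith

theorem dist_le_two_of_mem {x y : Plane} (hx : x ∈ unitSquare) (hy : y ∈ unitSquare) :
    dist x y ≤ 2 := by
  have key : ∀ i, |x i - y i| ≤ 1 := fun i => by
    have h1 := hx i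
    have h2 := hy i
    rw [Set.mem_Icc] at h1 h2
    rw [abs_le]; constructor <;> linarith
  linarith [dist_le_two_mul (key 0) (key 1)]

theorem IsEdgeWeight.nonneg (H : IsEdgeWeight h c₁ c₂ h₀) {x y : Plane} (hx : x ∈ unitSquare)
    (hy : y ∈ unitSquare) : 0 ≤ h x y :=
  le_trans (mul_nonneg H.c₁_pos.le dist_nonneg) (H.equiv x hx y hy).1

theorem IsEdgeWeight.rpow_le (H : IsEdgeWeight h c₁ c₂ h₀) (hα₀ : 0 < α) {x y : Plane} {d : ℝ}
    (hx : x ∈ unitSquare) (hy : y ∈ unitSquare) (hd : dist x y ≤ d) :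
    h x y ^ α ≤ (c₂ * d) ^ α :=
  Real.rpow_le_rpow (H.nonneg hx hy) ((H.equiv x hx y hy).2.2.trans
    (mul_le_mul_of_nonneg_left hd H.c₂_pos.le)) hα₀.le

theorem cellMap_apply_zero (m : ℕ) (Q : Fin m × Fin m) (u : Plane) :
    cellMap m Q u 0 = (m : ℝ)⁻¹ * (((Q.1 : ℕ) : ℝ) + u 0) := by simp [cellMap, mul_add]

theorem cellMap_apply_one (m : ℕ) (Q : Fin m × Fin m) (u : Plane) :
    cellMap m Q u 1 = (m : ℝ)⁻¹ * (((Q.2 : ℕ) : ℝ) + u 1) := by simp [cellMap, mul_add]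

theorem cellMap_mem {m : ℕ} (Q : Fin m × Fin m) {u : Plane} (hu : u ∈ unitSquare) :
    cellMap m Q u ∈ unitSquare := by
  have key : ∀ (q : Fin m) (t : ℝ), t ∈ Set.Icc (0 : ℝ) 1 →
      (m : ℝ)⁻¹ * (((q : ℕ) : ℝ) + t) ∈ Set.Icc (0 : ℝ) 1 := by
    intro q t ht
    rw [Set.mem_Icc] at ht ⊢
    have hq : ((q : ℕ) : ℝ) + 1 ≤ m := by exact_mod_cast q.2
    have hq0 : (0 : ℝ) ≤ ((q : ℕ) : ℝ) := Nat.cast_nonneg _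
    have hm : (0 : ℝ) < m := by linarith
    refine ⟨by have := ht.1; positivity, ?_⟩
    rw [inv_mul_le_iff₀ hm]; linarith [ht.2]
  intro i
  fin_cases i
  · simpa only [Fin.zero_eta, cellMap_apply_zero] using key Q.1 _ (hu 0)
  · simpa only [Fin.mk_one, cellMap_apply_one] using key Q.2 _ (hu 1)

/-- Labels in one dyadic block differ by at most `2 ^ r - 1`, and the positions inside the cells add
at most 1. -/
theorem abs_div_sub_div_le {m r q q' : ℕ} {t t' : ℝ} (ht : t ∈ Set.Icc (0 : ℝ) 1)
    (ht' : t' ∈ Set.Icc (0 : ℝ) 1) (hq : q / 2 ^ r = q' / 2 ^ r) :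
    |(m : ℝ)⁻¹ * (q + t) - (m : ℝ)⁻¹ * (q' + t')| ≤ (m : ℝ)⁻¹ * 2 ^ r := by
  rw [← mul_sub, abs_mul, abs_of_nonneg (by positivity : (0 : ℝ) ≤ (m : ℝ)⁻¹)]
  refine mul_le_mul_of_nonneg_left ?_ (by positivity)
  have hp : 0 < 2 ^ r := by positivity
  have e1 := Nat.div_add_mod q (2 ^ r)
  have e2 := Nat.div_add_mod q' (2 ^ r)
  have l1 := Nat.mod_lt q hp
  have l2 := Nat.mod_lt q' hp
  have h1 : q + 1 ≤ q' + 2 ^ r := by rw [hq] at e1; omega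
  have h2 : q' + 1 ≤ q + 2 ^ r := by rw [hq] at e1; omega
  have h1' : (q : ℝ) + 1 ≤ q' + 2 ^ r := by exact_mod_cast h1
  have h2' : (q' : ℝ) + 1 ≤ q + 2 ^ r := by exact_mod_cast h2
  rw [Set.mem_Icc] at ht ht'
  rw [abs_le]; constructor <;> linarith

/-- Homogeneity gives `1 / m` and translation gives `h₀`. This is the only source of the factor `h₀
^ α` in the final bound. -/
theorem IsEdgeWeight.cellMap_le (H : IsEdgeWeight h c₁ c₂ h₀) (hα₀ : 0 < α) {m : ℕ} (hm : 1 ≤ m)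
    (Q : Fin m × Fin m) {u v : Plane} (hu : u ∈ unitSquare) (hv : v ∈ unitSquare) :
    h (cellMap m Q u) (cellMap m Q v) ^ α ≤ (h₀ / m) ^ α * h u v ^ α := by
  have hm' : (0 : ℝ) < m := by exact_mod_cast hm
  rw [← Real.mul_rpow (div_nonneg H.h₀_pos.le hm'.le) (H.nonneg hu hv)]
  refine Real.rpow_le_rpow (H.nonneg (cellMap_mem Q hu) (cellMap_mem Q hv)) ?_ hα₀.le
  unfold cellMap
  rw [H.scale _ (inv_pos.2 hm')]
  calc _ ≤ (m : ℝ)⁻¹ * (h₀ * h u v) :=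
        mul_le_mul_of_nonneg_left (H.trans _ _ _) (by positivity)
    _ = _ := by ring

theorem mem_cellNodes_iff {n m : ℕ} (l : Fin n → Fin m × Fin m) (Q : Fin m × Fin m) (i : Fin n) :
    i ∈ cellNodes l Q ↔ ∃ j, (cellNodes l Q).orderEmbOfFin rfl j = i := by
  rw [← Set.mem_range, Finset.range_orderEmbOfFin]; rfl

/-- Subadditivity of the travelling salesman weight over the cells of a grid. -/
theorem IsEdgeWeight.tspWeight_cellMap_le (H : IsEdgeWeight h c₁ c₂ h₀) (hα₀ : 0 < α)
    (hα₂ : α < 2) {n m : ℕ} (hm : 1 ≤ m) (l : Fin n → Fin m × Fin m) {u : Fin n → Plane}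
    (hu : ∀ i, u i ∈ unitSquare) :
    tspWeight h α (fun i => cellMap m (l i) (u i)) ≤
      (h₀ / m) ^ α * ∑ Q, cellTsp h α l Q u +
        24 * 2 ^ α / (4 - 2 ^ α) * (2 * c₂) ^ α * (m : ℝ) ^ (2 - α) := by
  classical
  have hm' : (0 : ℝ) < m := by exact_mod_cast hm
  have hc₂ := H.c₂_pos
  have hmem : ∀ i, cellMap m (l i) (u i) ∈ unitSquare := fun i => cellMap_mem _ (hu i)
  -- The dyadic square may exceed the grid; the extra cells are empty and get weight 0.
  let w : ℕ → ℕ → ℝ := fun a b =>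
    if hab : a < m ∧ b < m then (h₀ / m) ^ α * cellTsp h α l (⟨a, hab.1⟩, ⟨b, hab.2⟩) u else 0
  have key := hasTour_grid (f := fun i j => h (cellMap m (l i) (u i)) (cellMap m (l j) (u j)) ^ α)
    (l₁ := fun i => (l i).1) (l₂ := fun i => (l i).2) (D := (2 * c₂ / m) ^ α) hα₂
    (by positivity) (w := w) ?_ ?_ hm (fun i => ⟨(l i).1.2, (l i).2.2⟩) ?_
  · refine (tspWeight_le_of_hasTour key).trans (le_of_eq ?_)
    congr 1
    · rw [Finset.sum_range, Fintype.sum_prod_type, Finset.mul_sum]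
      refine Finset.sum_congr rfl fun a _ => ?_
      rw [Finset.sum_range, Finset.mul_sum]
      refine Finset.sum_congr rfl fun b _ => ?_
      simp [w]
    · rw [Real.div_rpow (by positivity) hm'.le, Real.rpow_sub hm', Real.rpow_two]
      ring
  · intro r i j h1 h2
    refine ⟨Real.rpow_nonneg (H.nonneg (hmem i) (hmem j)) _, ?_⟩
    have hd : dist (cellMap m (l i) (u i)) (cellMap m (l j) (u j)) ≤ 2 * ((m : ℝ)⁻¹ * 2 ^ r) := by
      apply dist_le_two_mul
      · rw [cellMap_apply_zero, cellMap_apply_zero]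
        exact abs_div_sub_div_le (hu i 0) (hu j 0) h1
      · rw [cellMap_apply_one, cellMap_apply_one]
        exact abs_div_sub_div_le (hu i 1) (hu j 1) h2
    refine (H.rpow_le hα₀ (hmem i) (hmem j) hd).trans (le_of_eq ?_)
    rw [← Real.rpow_natCast (2 ^ α) r, ← Real.rpow_mul (by norm_num), mul_comm α,
      Real.rpow_mul (by norm_num), Real.rpow_natCast,
      ← Real.mul_rpow (by positivity) (by positivity)]
    congr 1
    field_simp
  · intro a b
    by_cases hab : a < m ∧ b < m
    · simp only [w, dif_pos hab]
      have hset : (Finset.univ.filter fun i => ((l i).1 : ℕ) = a ∧ ((l i).2 : ℕ) = b) =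
          cellNodes l (⟨a, hab.1⟩, ⟨b, hab.2⟩) := by
        ext i
        simp [cellNodes, Prod.ext_iff, Fin.ext_iff]
      rw [hset]
      refine (hasTour_tspWeight u _ (RelEmbedding.injective _) _
        (mem_cellNodes_iff l _)).le_mul (Real.rpow_nonneg (div_nonneg H.h₀_pos.le hm'.le) _) ?_
      intro i hi j hj
      simp only [cellNodes, Finset.mem_filter, Finset.mem_univ, true_and] at hi hj
      rw [hi, hj]
      exact H.cellMap_le hα₀ hm _ (hu i) (hu j)
    · simp only [w, dif_neg hab]
      have hset : (Finset.univ.filter fun i => ((l i).1 : ℕ) = a ∧ ((l i).2 : ℕ) = b) = ∅ := by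
        ext i
        simp only [Finset.mem_filter, Finset.mem_univ, true_and, Finset.notMem_empty, iff_false]
        rintro ⟨rfl, rfl⟩
        exact hab ⟨(l i).1.2, (l i).2.2⟩
      rw [hset]
      simpa using hasTour_card_mul (f := fun i j =>
        h (cellMap m (l i) (u i)) (cellMap m (l j) (u j)) ^ α) (D := 0) ∅ (by simp)
  · intro a b hab
    simp only [w, dif_neg hab]

theorem IsEdgeWeight.tspWeight_nonneg (H : IsEdgeWeight h c₁ c₂ h₀) {n : ℕ} {x : Fin n → Plane}
    (hx : ∀ i, x i ∈ unitSquare) : 0 ≤ tspWeight h α x :=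
  Finset.le_inf' _ _ fun _ _ => Finset.sum_nonneg fun _ _ =>
    Real.rpow_nonneg (H.nonneg (hx _) (hx _)) _

theorem IsEdgeWeight.tspWeight_le (H : IsEdgeWeight h c₁ c₂ h₀) (hα₀ : 0 < α) {n : ℕ}
    {x : Fin n → Plane} (hx : ∀ i, x i ∈ unitSquare) :
    tspWeight h α x ≤ n * (2 * c₂) ^ α := by
  apply tspWeight_le_of_hasTour
  have := hasTour_card_mul (f := fun i j => h (x i) (x j) ^ α) (D := (2 * c₂) ^ α) Finset.univ
    (fun i _ j _ => by
      rw [mul_comm]; exact H.rpow_le hα₀ (hx i) (hx j) (dist_le_two_of_mem (hx i) (hx j)))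
  simpa using this

theorem IsEdgeWeight.tspWeight_add_le (H : IsEdgeWeight h c₁ c₂ h₀) (hα₀ : 0 < α) {a b : ℕ}
    {x : Fin (a + b) → Plane} (hx : ∀ i, x i ∈ unitSquare) :
    tspWeight h α x ≤ tspWeight h α (fun i => x (Fin.castAdd b i)) +
      tspWeight h α (fun i => x (Fin.natAdd a i)) + 2 * (2 * c₂) ^ α := by
  classical
  have hc₂ := H.c₂_pos
  apply tspWeight_le_of_hasTour
  have h1 := hasTour_tspWeight (h := h) (α := α) x (Fin.castAdd b) (Fin.castAdd_injective a b)
    (Finset.univ.filter fun i => (i : ℕ) < a) (fun i => by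
      simp only [Finset.mem_filter, Finset.mem_univ, true_and]
      exact ⟨fun hi => ⟨⟨i, hi⟩, rfl⟩, by rintro ⟨j, rfl⟩; simp⟩)
  have h2 := hasTour_tspWeight (h := h) (α := α) x (Fin.natAdd a) (Fin.natAdd_injective b a)
    (Finset.univ.filter fun i => ¬ (i : ℕ) < a) (fun i => by
      simp only [Finset.mem_filter, Finset.mem_univ, true_and]
      refine ⟨fun hi => ⟨⟨i - a, by omega⟩, Fin.ext (by simp; omega)⟩, ?_⟩
      rintro ⟨j, rfl⟩; simp)
  have := h1.union h2 (D := (2 * c₂) ^ α) (Finset.disjoint_filter_filter_not _ _ _) (by positivity)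
    (fun i _ j _ => ⟨Real.rpow_nonneg (H.nonneg (hx i) (hx j)) _, by
      rw [mul_comm]; exact H.rpow_le hα₀ (hx i) (hx j) (dist_le_two_of_mem (hx i) (hx j))⟩)
  rwa [Finset.filter_union_filter_not_eq] at this

end Geometry

/-! ### The uniform law as a mixture over the cells of a grid. -/

/-- The uniform distribution on the unit square. -/
noncomputable def unifSquare : Measure Plane := volume.restrict unitSquare

/-- The unit square without its upper and right sides. -/
def halfOpenSquare : Set Plane := {x | ∀ i, x i ∈ Set.Ico (0 : ℝ) 1}

/-- The half open cell `Q` of the `m × m` grid. -/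
def gridCell (m : ℕ) (Q : Fin m × Fin m) : Set Plane :=
  {x | (m : ℝ) * x 0 ∈ Set.Ico ((Q.1 : ℕ) : ℝ) ((Q.1 : ℕ) + 1) ∧
    (m : ℝ) * x 1 ∈ Set.Ico ((Q.2 : ℕ) : ℝ) ((Q.2 : ℕ) + 1)}

section Uniform

theorem measurableSet_unitSquare : MeasurableSet unitSquare := by
  have : unitSquare = ⋂ i, (fun x : Plane => x i) ⁻¹' Set.Icc (0 : ℝ) 1 := by
    ext x; simp [unitSquare]
  rw [this]
  exact MeasurableSet.iInter fun i => measurableSet_preimage (by fun_prop) measurableSet_Icc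

theorem unitSquare_eq_preimage : unitSquare =
    (WithLp.ofLp : Plane → Fin 2 → ℝ) ⁻¹' Set.Icc (fun _ => 0) (fun _ => 1) := by
  ext x; simp [unitSquare, Pi.le_def, forall_and]

theorem volume_unitSquare : volume unitSquare = 1 := by
  rw [unitSquare_eq_preimage, (PiLp.volume_preserving_ofLp (Fin 2)).measure_preimage
    measurableSet_Icc.nullMeasurableSet, Real.volume_Icc_pi]
  simp

instance : IsProbabilityMeasure unifSquare :=
  ⟨by rw [unifSquare, Measure.restrict_apply_univ, volume_unitSquare]⟩

/-- Half open cells partition the half open square exactly; the price is a null set. -/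
theorem halfOpenSquare_ae_eq : halfOpenSquare =ᵐ[volume] unitSquare := by
  have h : halfOpenSquare = (WithLp.ofLp : Plane → Fin 2 → ℝ) ⁻¹'
      (Set.univ.pi fun _ => Set.Ico 0 1) := by
    ext x; simp [halfOpenSquare]
  rw [h, unitSquare_eq_preimage]
  exact (PiLp.volume_preserving_ofLp (Fin 2)).quasiMeasurePreserving.preimage_ae_eq
    Measure.univ_pi_Ico_ae_eq_Icc

theorem unifSquare_eq_halfOpen : unifSquare = volume.restrict halfOpenSquare :=
  (Measure.restrict_congr_set halfOpenSquare_ae_eq).symm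

theorem measurable_cellMap (m : ℕ) (Q : Fin m × Fin m) : Measurable (cellMap m Q) := by
  unfold cellMap; fun_prop

theorem measurableSet_gridCell (m : ℕ) (Q : Fin m × Fin m) : MeasurableSet (gridCell m Q) := by
  unfold gridCell
  apply MeasurableSet.inter
  · exact measurableSet_preimage (f := fun x : Plane => (m : ℝ) * x 0) (by fun_prop)
      measurableSet_Ico
  · exact measurableSet_preimage (f := fun x : Plane => (m : ℝ) * x 1) (by fun_prop)
      measurableSet_Ico

theorem preimage_gridCell {m : ℕ} (hm : 1 ≤ m) (Q : Fin m × Fin m) :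
    cellMap m Q ⁻¹' gridCell m Q = halfOpenSquare := by
  have hm' : (m : ℝ) ≠ 0 := by positivity
  ext x
  simp only [Set.mem_preimage, gridCell, Set.mem_ofPred_eq, cellMap_apply_zero, cellMap_apply_one,
    mul_inv_cancel_left₀ hm', halfOpenSquare, Fin.forall_fin_two, Set.mem_Ico]
  constructor
  · rintro ⟨⟨h1, h2⟩, h3, h4⟩; refine ⟨⟨?_, ?_⟩, ?_, ?_⟩ <;> linarith
  · rintro ⟨⟨h1, h2⟩, h3, h4⟩; refine ⟨⟨?_, ?_⟩, ?_, ?_⟩ <;> linarith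

theorem iUnion_gridCell {m : ℕ} (hm : 1 ≤ m) : ⋃ Q, gridCell m Q = halfOpenSquare := by
  have hm' : (0 : ℝ) < m := by positivity
  have key : ∀ t : ℝ, (∃ q : Fin m, (m : ℝ) * t ∈ Set.Ico ((q : ℕ) : ℝ) ((q : ℕ) + 1)) ↔
      t ∈ Set.Ico (0 : ℝ) 1 := by
    intro t
    simp only [Set.mem_Ico]
    constructor
    · rintro ⟨q, h1, h2⟩
      have hq : ((q : ℕ) : ℝ) + 1 ≤ m := by exact_mod_cast q.2
      have hq0 : (0 : ℝ) ≤ ((q : ℕ) : ℝ) := Nat.cast_nonneg _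
      constructor
      · exact nonneg_of_mul_nonneg_right (hq0.trans h1) hm'
      · by_contra hcon
        nlinarith
    · rintro ⟨h1, h2⟩
      have h0 : 0 ≤ (m : ℝ) * t := by positivity
      refine ⟨⟨⌊(m : ℝ) * t⌋₊, (Nat.floor_lt h0).2 (by nlinarith)⟩, Nat.floor_le h0,
        Nat.lt_floor_add_one _⟩
  ext x
  simp only [Set.mem_iUnion, gridCell, Set.mem_ofPred_eq, halfOpenSquare, Fin.forall_fin_two,
    ← key, Prod.exists]
  constructor
  · rintro ⟨a, b, h1, h2⟩; exact ⟨⟨a, h1⟩, b, h2⟩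
  · rintro ⟨⟨a, h1⟩, b, h2⟩; exact ⟨a, b, h1, h2⟩

theorem pairwise_disjoint_gridCell (m : ℕ) :
    Pairwise (Function.onFun Disjoint (gridCell m)) := by
  have key : ∀ (t : ℝ) (a b : ℕ), t ∈ Set.Ico (a : ℝ) (a + 1) → t ∈ Set.Ico (b : ℝ) (b + 1) →
      a = b := by
    intro t a b ha hb
    have h1 : (a : ℝ) < b + 1 := ha.1.trans_lt hb.2
    have h2 : (b : ℝ) < a + 1 := hb.1.trans_lt ha.2
    have h1' : a < b + 1 := by exact_mod_cast h1
    have h2' : b < a + 1 := by exact_mod_cast h2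
    omega
  intro Q R hQR
  refine Set.disjoint_left.2 fun x hx hx' => hQR ?_
  exact Prod.ext (Fin.ext (key _ _ _ hx.1 hx'.1)) (Fin.ext (key _ _ _ hx.2 hx'.2))

theorem map_cellMap_volume {m : ℕ} (hm : 1 ≤ m) (Q : Fin m × Fin m) :
    (volume : Measure Plane).map (cellMap m Q) = ENNReal.ofReal ((m : ℝ) ^ 2) • volume := by
  have hm' : (m : ℝ) ≠ 0 := by positivity
  have hcomp : cellMap m Q = (fun x : Plane => (m : ℝ)⁻¹ • x) ∘
      (fun u : Plane => !₂[((Q.1 : ℕ) : ℝ), ((Q.2 : ℕ) : ℝ)] + u) := rfl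
  rw [hcomp, ← Measure.map_map (by fun_prop) (by fun_prop), MeasureTheory.map_add_left_eq_self,
    Measure.map_addHaar_smul _ (inv_ne_zero hm'), finrank_euclideanSpace_fin]
  congr 2
  rw [inv_pow, inv_inv, abs_of_nonneg (by positivity)]

/-- The uniform distribution on the square is the mixture of those on the cells of a grid. -/
theorem unifSquare_eq_sum {m : ℕ} (hm : 1 ≤ m) :
    unifSquare = ∑ Q, ENNReal.ofReal (((m : ℝ) ^ 2)⁻¹) • unifSquare.map (cellMap m Q) := by
  have hm' : (0 : ℝ) < (m : ℝ) ^ 2 := by positivity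
  have h : ∀ Q, ENNReal.ofReal (((m : ℝ) ^ 2)⁻¹) • unifSquare.map (cellMap m Q) =
      volume.restrict (gridCell m Q) := by
    intro Q
    rw [unifSquare_eq_halfOpen, ← preimage_gridCell hm Q,
      ← Measure.restrict_map (measurable_cellMap m Q) (measurableSet_gridCell m Q),
      map_cellMap_volume hm, Measure.restrict_smul, smul_smul,
      ← ENNReal.ofReal_mul (by positivity), inv_mul_cancel₀ hm'.ne', ENNReal.ofReal_one, one_smul]
  simp_rw [h]
  rw [unifSquare_eq_halfOpen, ← iUnion_gridCell hm,
    Measure.restrict_iUnion (pairwise_disjoint_gridCell m) (measurableSet_gridCell m),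
    Measure.sum_fintype]

/-- A product of mixtures is the mixture of products over all labellings: the product of the sums is
expanded on boxes. -/
theorem pi_sum_smul {κ E : Type*} [Fintype κ] [MeasurableSpace E] (n : ℕ) (c : ENNReal)
    (ν : κ → Measure E) [∀ k, IsProbabilityMeasure (ν k)] (μ : Measure E) [SigmaFinite μ]
    (hμ : μ = ∑ k, c • ν k) :
    Measure.pi (fun _ : Fin n => μ) = ∑ l : Fin n → κ, c ^ n • Measure.pi fun i => ν (l i) := by
  classical
  refine Measure.pi_eq fun s hs => ?_
  have h1 : ∀ i, μ (s i) = ∑ k, c * ν k (s i) := fun i => by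
    rw [hμ, Measure.finsetSum_apply]; rfl
  simp_rw [h1]
  rw [Finset.prod_univ_sum, Fintype.piFinset_univ, Measure.finsetSum_apply]
  refine Finset.sum_congr rfl fun l _ => ?_
  rw [Measure.smul_apply, Measure.pi_pi, Finset.prod_mul_distrib]
  simp

theorem ae_pi_unifSquare (n : ℕ) :
    ∀ᵐ u ∂Measure.pi (fun _ : Fin n => unifSquare), ∀ i, u i ∈ unitSquare := by
  rw [ae_all_iff]
  intro i
  have h : ∀ᵐ x ∂unifSquare, x ∈ unitSquare := ae_restrict_mem measurableSet_unitSquare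
  exact (Measure.tendsto_eval_ae_ae (μ := fun _ : Fin n => unifSquare) (i := i)).eventually h

/-- Any `k` of the `n` nodes are again independent and uniform, so a cell holding `k` nodes
contributes `meanTsp h α k`. -/
theorem map_comp_pi_unifSquare {n k : ℕ} (e : Fin k → Fin n) (he : Function.Injective e) :
    (Measure.pi fun _ : Fin n => unifSquare).map (fun u j => u (e j)) =
      Measure.pi fun _ : Fin k => unifSquare := by
  have h1 : ProbabilityTheory.iIndepFun (fun (i : Fin n) (u : Fin n → Plane) => u i)
      (Measure.pi fun _ : Fin n => unifSquare) :=
    ProbabilityTheory.iIndepFun_pi (X := fun _ x => x) (fun i => aemeasurable_id)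
  have h2 := (ProbabilityTheory.iIndepFun_iff_map_fun_eq_pi_map
    (fun j => (measurable_pi_apply (e j)).aemeasurable)).1 (h1.precomp he)
  rw [h2]
  congr 1
  ext1 j
  exact (measurePreserving_eval (fun _ : Fin n => unifSquare) (e j)).map_eq

end Uniform

/-! ### Integrability and the inequalities for the mean weight. -/

/-- The mean travelling salesman weight of `n` independent uniform nodes. -/
noncomputable def meanTsp (h : Plane → Plane → ℝ) (α : ℝ) (n : ℕ) : ℝ :=
  ∫ x, tspWeight h α x ∂Measure.pi fun _ : Fin n => unifSquare

section Mean

variable {h : Plane → Plane → ℝ} {c₁ c₂ h₀ α : ℝ}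

theorem IsEdgeWeight.measurable_tspWeight (H : IsEdgeWeight h c₁ c₂ h₀) (n : ℕ) :
    Measurable (fun x : Fin n → Plane => tspWeight h α x) := by
  have h1 : ∀ σ ∈ (Finset.univ : Finset (Equiv.Perm (Fin n))),
      Measurable (fun x : Fin n → Plane => cycleWeight h α x σ) := by
    intro σ _
    unfold cycleWeight
    refine Finset.measurable_sum _ fun j _ => ?_
    have : Measurable (fun x : Fin n → Plane => h (x (σ j)) (x (σ (finRotate n j)))) :=
      H.meas.comp (f := fun x : Fin n → Plane => (x (σ j), x (σ (finRotate n j)))) (by fun_prop)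
    exact this.pow_const _
  have h2 : Measurable (Finset.univ.inf' Finset.univ_nonempty
      fun (σ : Equiv.Perm (Fin n)) (x : Fin n → Plane) => cycleWeight h α x σ) :=
    Finset.inf'_induction _ _ (fun _ hf _ hg => hf.inf hg) h1
  convert h2 using 1
  ext x
  rw [Finset.inf'_apply]
  rfl

theorem IsEdgeWeight.integrable_tspWeight (H : IsEdgeWeight h c₁ c₂ h₀) (hα₀ : 0 < α) (n : ℕ) :
    Integrable (fun x : Fin n → Plane => tspWeight h α x)
      (Measure.pi fun _ : Fin n => unifSquare) := by
  refine Integrable.of_bound (H.measurable_tspWeight n).aestronglyMeasurable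
    (n * (2 * c₂) ^ α) ?_
  filter_upwards [ae_pi_unifSquare n] with x hx
  rw [Real.norm_of_nonneg (H.tspWeight_nonneg hx)]
  exact H.tspWeight_le hα₀ hx

theorem IsEdgeWeight.meanTsp_nonneg (H : IsEdgeWeight h c₁ c₂ h₀) (n : ℕ) :
    0 ≤ meanTsp h α n :=
  integral_nonneg_of_ae (by
    filter_upwards [ae_pi_unifSquare n] with x hx using H.tspWeight_nonneg hx)

theorem IsEdgeWeight.meanTsp_le_mul (H : IsEdgeWeight h c₁ c₂ h₀) (hα₀ : 0 < α) (n : ℕ) :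
    meanTsp h α n ≤ n * (2 * c₂) ^ α := by
  have : meanTsp h α n ≤ ∫ _, n * (2 * c₂) ^ α ∂Measure.pi fun _ : Fin n => unifSquare := by
    refine integral_mono_ae (H.integrable_tspWeight hα₀ n) (integrable_const _) ?_
    filter_upwards [ae_pi_unifSquare n] with x hx using H.tspWeight_le hα₀ hx
  simpa using this

theorem IsEdgeWeight.integrable_tspWeight_comp (H : IsEdgeWeight h c₁ c₂ h₀) (hα₀ : 0 < α)
    {n k : ℕ} (e : Fin k → Fin n) (he : Function.Injective e) :
    Integrable (fun u : Fin n → Plane => tspWeight h α (fun j => u (e j)))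
      (Measure.pi fun _ : Fin n => unifSquare) := by
  have := H.integrable_tspWeight hα₀ k
  rw [← map_comp_pi_unifSquare e he] at this
  exact this.comp_measurable (by fun_prop)

theorem IsEdgeWeight.integral_tspWeight_comp (H : IsEdgeWeight h c₁ c₂ h₀)
    {n k : ℕ} (e : Fin k → Fin n) (he : Function.Injective e) :
    ∫ u, tspWeight h α (fun j => u (e j)) ∂(Measure.pi fun _ : Fin n => unifSquare) =
      meanTsp h α k := by
  rw [meanTsp, ← map_comp_pi_unifSquare e he, integral_map
    (measurable_pi_lambda _ fun j => measurable_pi_apply (e j)).aemeasurable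
    (H.measurable_tspWeight k).aestronglyMeasurable]

theorem IsEdgeWeight.meanTsp_add_le (H : IsEdgeWeight h c₁ c₂ h₀) (hα₀ : 0 < α) (a b : ℕ) :
    meanTsp h α (a + b) ≤ meanTsp h α a + meanTsp h α b + 2 * (2 * c₂) ^ α := by
  have i1 := H.integrable_tspWeight_comp hα₀ (Fin.castAdd b) (Fin.castAdd_injective a b)
  have i2 := H.integrable_tspWeight_comp hα₀ (Fin.natAdd a) (Fin.natAdd_injective b a)
  rw [← H.integral_tspWeight_comp (Fin.castAdd b) (Fin.castAdd_injective a b),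
    ← H.integral_tspWeight_comp (Fin.natAdd a) (Fin.natAdd_injective b a),
    ← integral_add i1 i2]
  have : ∀ g : (Fin (a + b) → Plane) → ℝ,
      Integrable g (Measure.pi fun _ : Fin (a + b) => unifSquare) →
      ∫ u, g u ∂(Measure.pi fun _ : Fin (a + b) => unifSquare) + 2 * (2 * c₂) ^ α =
      ∫ u, (g u + 2 * (2 * c₂) ^ α) ∂(Measure.pi fun _ : Fin (a + b) => unifSquare) := by
    intro g hg
    rw [integral_add hg (integrable_const _)]; simp
  refine le_trans ?_ (this _ (i1.add i2)).ge
  refine integral_mono_ae (H.integrable_tspWeight hα₀ _)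
    ((i1.add i2).add (integrable_const _)) ?_
  filter_upwards [ae_pi_unifSquare (a + b)] with x hx using H.tspWeight_add_le hα₀ hx

/-- Averaging of `IsEdgeWeight.tspWeight_cellMap_le`: all labellings `l` are equally likely, and for
each of them the positions inside the cells are independent and uniform. -/
theorem IsEdgeWeight.meanTsp_le_cells (H : IsEdgeWeight h c₁ c₂ h₀) (hα₀ : 0 < α) (hα₂ : α < 2)
    (n : ℕ) {m : ℕ} (hm : 1 ≤ m) :
    meanTsp h α n ≤ (h₀ / m) ^ α * ∑ Q : Fin m × Fin m, ∑ l : Fin n → Fin m × Fin m,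
        (((m : ℝ) ^ 2)⁻¹) ^ n * meanTsp h α (cellNodes l Q).card +
      24 * 2 ^ α / (4 - 2 ^ α) * (2 * c₂) ^ α * (m : ℝ) ^ (2 - α) := by
  classical
  set K : ℝ := 24 * 2 ^ α / (4 - 2 ^ α) * (2 * c₂) ^ α * (m : ℝ) ^ (2 - α)
  have hm' : (0 : ℝ) < (m : ℝ) ^ 2 := by positivity
  have hprob : ∀ Q, IsProbabilityMeasure (unifSquare.map (cellMap m Q)) := fun Q =>
    Measure.isProbabilityMeasure_map (measurable_cellMap m Q).aemeasurable
  have hpi : ∀ l : Fin n → Fin m × Fin m,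
      (Measure.pi fun i => unifSquare.map (cellMap m (l i))) =
        (Measure.pi fun _ : Fin n => unifSquare).map (fun u i => cellMap m (l i) (u i)) :=
    fun l => (Measure.pi_map_pi fun i => (measurable_cellMap m (l i)).aemeasurable).symm
  have hmeas : ∀ l : Fin n → Fin m × Fin m,
      Measurable (fun (u : Fin n → Plane) i => cellMap m (l i) (u i)) := fun l =>
    measurable_pi_lambda _ fun i => (measurable_cellMap m (l i)).comp (measurable_pi_apply i)
  have hint : ∀ l : Fin n → Fin m × Fin m,
      Integrable (fun u => tspWeight h α (fun i => cellMap m (l i) (u i)))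
        (Measure.pi fun _ : Fin n => unifSquare) := by
    intro l
    refine Integrable.of_bound ((H.measurable_tspWeight n).comp (hmeas l)).aestronglyMeasurable
      (n * (2 * c₂) ^ α) ?_
    filter_upwards [ae_pi_unifSquare n] with x hx
    have hx' : ∀ i, cellMap m (l i) (x i) ∈ unitSquare := fun i => cellMap_mem _ (hx i)
    rw [Real.norm_of_nonneg (H.tspWeight_nonneg hx')]
    exact H.tspWeight_le hα₀ hx'
  have hcell : ∀ l : Fin n → Fin m × Fin m,
      ∫ u, tspWeight h α (fun i => cellMap m (l i) (u i))
        ∂(Measure.pi fun _ : Fin n => unifSquare) ≤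
      (h₀ / m) ^ α * ∑ Q, meanTsp h α (cellNodes l Q).card + K := by
    intro l
    have hi : ∀ Q, Integrable (cellTsp h α l Q) (Measure.pi fun _ : Fin n => unifSquare) :=
      fun Q => H.integrable_tspWeight_comp hα₀ _ (RelEmbedding.injective _)
    have hsum : Integrable (fun u => (h₀ / m) ^ α * ∑ Q, cellTsp h α l Q u)
        (Measure.pi fun _ : Fin n => unifSquare) :=
      (integrable_finsetSum _ fun Q _ => hi Q).const_mul _
    calc _ ≤ ∫ u, ((h₀ / m) ^ α * ∑ Q, cellTsp h α l Q u + K)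
          ∂(Measure.pi fun _ : Fin n => unifSquare) := by
          refine integral_mono_ae (hint l) (hsum.add (integrable_const _)) ?_
          filter_upwards [ae_pi_unifSquare n] with x hx
          exact H.tspWeight_cellMap_le hα₀ hα₂ hm l hx
      _ = _ := by
          rw [integral_add hsum (integrable_const _), integral_const_mul,
            integral_finsetSum _ fun Q _ => hi Q]
          have : ∀ Q, ∫ u, cellTsp h α l Q u ∂(Measure.pi fun _ : Fin n => unifSquare) =
              meanTsp h α (cellNodes l Q).card := fun Q =>
            H.integral_tspWeight_comp _ (RelEmbedding.injective _)
          simp [this]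
  have hmean : meanTsp h α n = ∑ l : Fin n → Fin m × Fin m, (((m : ℝ) ^ 2)⁻¹) ^ n *
      ∫ u, tspWeight h α (fun i => cellMap m (l i) (u i))
        ∂(Measure.pi fun _ : Fin n => unifSquare) := by
    rw [meanTsp]
    conv_lhs =>
      rw [pi_sum_smul n _ (fun Q => unifSquare.map (cellMap m Q)) _ (unifSquare_eq_sum hm)]
    have hint' : ∀ l : Fin n → Fin m × Fin m,
        Integrable (fun x : Fin n → Plane => tspWeight h α x)
          (Measure.pi fun i => unifSquare.map (cellMap m (l i))) := by
      intro l
      rw [hpi]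
      exact (integrable_map_measure (H.measurable_tspWeight n).aestronglyMeasurable
        (hmeas l).aemeasurable).2 (hint l)
    rw [integral_finsetSum_measure fun l _ => (hint' l).smul_measure (by simp)]
    refine Finset.sum_congr rfl fun l _ => ?_
    rw [integral_smul_measure, hpi, integral_map (hmeas l).aemeasurable
      (H.measurable_tspWeight n).aestronglyMeasurable, ENNReal.toReal_pow,
      ENNReal.toReal_ofReal (by positivity), smul_eq_mul]
  have hone : ∑ _l : Fin n → Fin m × Fin m, (((m : ℝ) ^ 2)⁻¹) ^ n = 1 := by
    simp only [Finset.sum_const, Finset.card_univ, Fintype.card_fun, Fintype.card_prod,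
      Fintype.card_fin, nsmul_eq_mul]
    push_cast
    rw [← pow_two, ← mul_pow, mul_inv_cancel₀ hm'.ne', one_pow]
  rw [hmean]
  calc _ ≤ ∑ l : Fin n → Fin m × Fin m, (((m : ℝ) ^ 2)⁻¹) ^ n *
        ((h₀ / m) ^ α * ∑ Q, meanTsp h α (cellNodes l Q).card + K) :=
        Finset.sum_le_sum fun l _ => mul_le_mul_of_nonneg_left (hcell l) (by positivity)
    _ = _ := by
        simp_rw [mul_add, Finset.sum_add_distrib]
        rw [← Finset.sum_mul, hone, one_mul, Finset.sum_comm, Finset.mul_sum]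
        congr 1
        refine Finset.sum_congr rfl fun l _ => ?_
        rw [← Finset.mul_sum]; ring

theorem IsEdgeWeight.tspOf_integrable_and_integral (H : IsEdgeWeight h c₁ c₂ h₀) (hα₀ : 0 < α)
    {Ω : Type*} [MeasurableSpace Ω] {P : Measure Ω} [IsProbabilityMeasure P] {X : ℕ → Ω → Plane}
    (hX_meas : ∀ i, Measurable (X i)) (hX_indep : ProbabilityTheory.iIndepFun X P)
    (hX_law : ∀ i, P.map (X i) = unifSquare) (n : ℕ) :
    Integrable (tspOf h α X n) P ∧ ∫ ω, tspOf h α X n ω ∂P = meanTsp h α n := by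
  have hmap : P.map (fun ω (i : Fin n) => X i ω) = Measure.pi fun _ : Fin n => unifSquare := by
    rw [(ProbabilityTheory.iIndepFun_iff_map_fun_eq_pi_map
      (fun i : Fin n => (hX_meas i).aemeasurable)).1 (hX_indep.precomp Fin.val_injective)]
    simp_rw [hX_law]
  have hm : Measurable (fun ω (i : Fin n) => X i ω) := measurable_pi_lambda _ fun i => hX_meas i
  constructor
  · have := H.integrable_tspWeight hα₀ n
    rw [← hmap] at this
    exact this.comp_measurable hm
  · rw [meanTsp, ← hmap, integral_map hm.aemeasurable
      (H.measurable_tspWeight n).aestronglyMeasurable]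
    rfl

end Mean

/-! ### Lower bound of order n^(1-α/2). -/

section LowerBound

variable {h : Plane → Plane → ℝ} {c₁ c₂ h₀ α : ℝ}

theorem prod_unifSquare_dist_lt (r : ℝ) :
    (unifSquare.prod unifSquare) {p | dist p.1 p.2 < r} ≤
      ENNReal.ofReal r ^ 2 * ENNReal.ofReal Real.pi := by
  have hms : MeasurableSet {p : Plane × Plane | dist p.1 p.2 < r} :=
    measurableSet_lt (by fun_prop) measurable_const
  rw [Measure.prod_apply hms]
  calc _ ≤ ∫⁻ _, ENNReal.ofReal r ^ 2 * ENNReal.ofReal Real.pi ∂unifSquare := by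
        refine lintegral_mono fun x => ?_
        have : Prod.mk x ⁻¹' {p : Plane × Plane | dist p.1 p.2 < r} = Metric.ball x r := by
          ext y; rw [Metric.mem_ball']; rfl
        rw [this, ← EuclideanSpace.volume_ball_fin_two x r]
        exact Measure.restrict_apply_le _ _
    _ = _ := by simp

theorem pi_unifSquare_dist_lt {n : ℕ} {i j : Fin n} (hij : i ≠ j) {r : ℝ} (hr : 0 ≤ r) :
    (Measure.pi fun _ : Fin n => unifSquare).real {x | dist (x i) (x j) < r} ≤ 4 * r ^ 2 := by
  have h1 : ProbabilityTheory.iIndepFun (fun (i : Fin n) (u : Fin n → Plane) => u i)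
      (Measure.pi fun _ : Fin n => unifSquare) :=
    ProbabilityTheory.iIndepFun_pi (X := fun _ x => x) (fun i => aemeasurable_id)
  have h2 := (ProbabilityTheory.indepFun_iff_map_prod_eq_prod_map_map
    (measurable_pi_apply i).aemeasurable (measurable_pi_apply j).aemeasurable).1 (h1.indepFun hij)
  rw [(measurePreserving_eval (fun _ : Fin n => unifSquare) i).map_eq,
    (measurePreserving_eval (fun _ : Fin n => unifSquare) j).map_eq] at h2
  have hms : MeasurableSet {p : Plane × Plane | dist p.1 p.2 < r} :=
    measurableSet_lt (by fun_prop) measurable_const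
  have h3 := prod_unifSquare_dist_lt r
  rw [← h2, Measure.map_apply (by fun_prop) hms] at h3
  have h4 := ENNReal.toReal_mono (by finiteness) h3
  rw [ENNReal.toReal_mul, ENNReal.toReal_pow, ENNReal.toReal_ofReal hr,
    ENNReal.toReal_ofReal Real.pi_pos.le] at h4
  refine h4.trans ?_
  nlinarith [Real.pi_le_four, sq_nonneg r]

/-- The edge leaving node `i` weighs at least `(c₁ * r) ^ α` unless another node lies within `r` of
it. The indicator of isolation is at least 1 minus the number of such nodes, whose mean needs only
pairs. -/
theorem IsEdgeWeight.le_tspWeight (H : IsEdgeWeight h c₁ c₂ h₀) (hα₀ : 0 < α) {n : ℕ}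
    (hn : 2 ≤ n) {x : Fin n → Plane} (hx : ∀ i, x i ∈ unitSquare) {r : ℝ} (hr : 0 ≤ r) :
    (c₁ * r) ^ α * ∑ i, (1 - ∑ j ∈ Finset.univ.erase i,
      Set.indicator {y : Fin n → Plane | dist (y i) (y j) < r} (fun _ => (1 : ℝ)) x) ≤
      tspWeight h α x := by
  -- With at least two nodes the cyclic successor of a node is a different node.
  obtain ⟨n, rfl⟩ : ∃ k, n = k + 2 := ⟨n - 2, by omega⟩
  refine Finset.le_inf' _ _ fun σ _ => ?_
  rw [← Equiv.sum_comp σ, Finset.mul_sum]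
  refine Finset.sum_le_sum fun k _ => ?_
  have hc := H.c₁_pos
  have hne : σ (finRotate (n + 2) k) ≠ σ k := by
    rw [Ne, σ.injective.eq_iff, finRotate_apply]
    simp
  have hnn : ∀ j, 0 ≤ Set.indicator {y : Fin (n + 2) → Plane | dist (y (σ k)) (y j) < r}
      (fun _ => (1 : ℝ)) x := fun j => Set.indicator_nonneg (fun _ _ => zero_le_one) _
  have hp : 0 ≤ (c₁ * r) ^ α := by positivity
  by_cases hd : dist (x (σ k)) (x (σ (finRotate (n + 2) k))) < r
  · have h1 : 1 ≤ ∑ j ∈ Finset.univ.erase (σ k),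
        Set.indicator {y : Fin (n + 2) → Plane | dist (y (σ k)) (y j) < r}
          (fun _ => (1 : ℝ)) x := by
      refine le_trans (le_of_eq ?_) (Finset.single_le_sum (fun j _ => hnn j)
        (Finset.mem_erase.2 ⟨hne, Finset.mem_univ _⟩))
      rw [Set.indicator_of_mem (by exact hd)]
    exact (mul_nonpos_of_nonneg_of_nonpos hp (by linarith)).trans
      (Real.rpow_nonneg (H.nonneg (hx _) (hx _)) _)
  · have h1 := Finset.sum_nonneg (s := Finset.univ.erase (σ k)) fun j _ => hnn j
    refine (mul_le_of_le_one_right hp (by linarith)).trans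
      (Real.rpow_le_rpow (by positivity) ?_ hα₀.le)
    exact (mul_le_mul_of_nonneg_left (not_lt.1 hd) hc.le).trans (H.equiv _ (hx _) _ (hx _)).1

theorem IsEdgeWeight.le_meanTsp (H : IsEdgeWeight h c₁ c₂ h₀) (hα₀ : 0 < α) {n : ℕ}
    (hn : 2 ≤ n) : c₁ ^ α * 8 ^ (-(α / 2)) / 2 * (n : ℝ) ^ (1 - α / 2) ≤ meanTsp h α n := by
  have hc := H.c₁_pos
  have hn' : (0 : ℝ) < n := by positivity
  -- Chosen so that the mean number of other nodes within `r`, at most 4nr², is at most 1/2.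
  set r : ℝ := (8 * (n : ℝ)) ^ (-(1 / 2 : ℝ)) with hrdef
  have hr : 0 ≤ r := by positivity
  have hr2 : r ^ 2 = (8 * (n : ℝ))⁻¹ := by
    rw [hrdef, ← Real.rpow_natCast, ← Real.rpow_mul (by positivity)]
    norm_num
    rw [Real.rpow_neg_one]; ring
  have hrα : r ^ α = 8 ^ (-(α / 2)) * (n : ℝ) ^ (-(α / 2)) := by
    rw [hrdef, ← Real.rpow_mul (by positivity), Real.mul_rpow (by norm_num) hn'.le]
    ring_nf
  have hms : ∀ i j : Fin n, MeasurableSet {y : Fin n → Plane | dist (y i) (y j) < r} :=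
    fun i j => measurableSet_lt (by fun_prop) measurable_const
  have hi : ∀ i j : Fin n, Integrable
      (Set.indicator {y : Fin n → Plane | dist (y i) (y j) < r} (fun _ => (1 : ℝ)))
      (Measure.pi fun _ : Fin n => unifSquare) :=
    fun i j => (integrable_const _).indicator (hms i j)
  have hi2 : ∀ i : Fin n, Integrable (fun x => 1 - ∑ j ∈ Finset.univ.erase i,
      Set.indicator {y : Fin n → Plane | dist (y i) (y j) < r} (fun _ => (1 : ℝ)) x)
      (Measure.pi fun _ : Fin n => unifSquare) := fun i =>
    (integrable_const _).sub (integrable_finsetSum _ fun j _ => hi i j)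
  have h1 : ∫ x, (c₁ * r) ^ α * ∑ i, (1 - ∑ j ∈ Finset.univ.erase i,
      Set.indicator {y : Fin n → Plane | dist (y i) (y j) < r} (fun _ => (1 : ℝ)) x)
      ∂(Measure.pi fun _ : Fin n => unifSquare) ≤ meanTsp h α n := by
    refine integral_mono_ae ((integrable_finsetSum _ fun i _ => hi2 i).const_mul _)
      (H.integrable_tspWeight hα₀ n) ?_
    filter_upwards [ae_pi_unifSquare n] with x hx using H.le_tspWeight hα₀ hn hx hr
  refine le_trans ?_ h1
  rw [integral_const_mul, integral_finsetSum _ fun i _ => hi2 i]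
  have h2 : ∀ i : Fin n, 1 / 2 ≤ ∫ x, (1 - ∑ j ∈ Finset.univ.erase i,
      Set.indicator {y : Fin n → Plane | dist (y i) (y j) < r} (fun _ => (1 : ℝ)) x)
      ∂(Measure.pi fun _ : Fin n => unifSquare) := by
    intro i
    rw [integral_sub (integrable_const _) (integrable_finsetSum _ fun j _ => hi i j),
      integral_finsetSum _ fun j _ => hi i j]
    have h3 : ∑ j ∈ Finset.univ.erase i, ∫ x,
        Set.indicator {y : Fin n → Plane | dist (y i) (y j) < r} (fun _ => (1 : ℝ)) x
        ∂(Measure.pi fun _ : Fin n => unifSquare) ≤ ∑ j : Fin n, 4 * r ^ 2 := by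
      refine (Finset.sum_le_sum fun j hj => ?_).trans (Finset.sum_le_sum_of_subset_of_nonneg
        (Finset.erase_subset i _) fun _ _ _ => by positivity)
      rw [integral_indicator_const _ (hms i j), smul_eq_mul, mul_one]
      exact pi_unifSquare_dist_lt (Finset.ne_of_mem_erase hj).symm hr
    have h4 : ∑ j : Fin n, 4 * r ^ 2 = 1 / 2 := by
      rw [hr2]; simp; field_simp; norm_num
    have h5 : ∫ _ : Fin n → Plane, (1 : ℝ) ∂(Measure.pi fun _ : Fin n => unifSquare) = 1 := by
      simp
    rw [h5]; linarith
  calc _ = (c₁ * r) ^ α * ∑ i : Fin n, (1 / 2 : ℝ) := by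
        rw [Real.mul_rpow hc.le hr, hrα, sub_eq_add_neg, Real.rpow_add hn', Real.rpow_one]
        simp; ring
    _ ≤ _ := by
        refine mul_le_mul_of_nonneg_left (Finset.sum_le_sum fun i _ => h2 i) (by positivity)

end LowerBound

/-! ### Moments of the number of nodes in a cell. -/

section Occupancy

variable {κ : Type*} [Fintype κ] [DecidableEq κ]

/-- First two moments of the number of balls in a box, for `n` balls in equally likely boxes. -/
theorem sum_occupancy_quadratic {q : ℝ} (hq : Fintype.card κ * q = 1) (k : κ) (n : ℕ)
    (A B C : ℝ) :
    ∑ l : Fin n → κ, q ^ n * (A + B * ((Finset.univ.filter fun i => l i = k).card : ℝ) +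
      C * ((Finset.univ.filter fun i => l i = k).card : ℝ) ^ 2) =
      A + B * (n * q) + C * (n * q + n * (n - 1) * q ^ 2) := by
  induction n generalizing A B C with
  | zero => simp
  | succ n ih =>
    rw [← (Fin.consEquiv fun _ : Fin (n + 1) => κ).sum_comp, Fintype.sum_prod_type]
    have hcard : ∀ (a : κ) (l : Fin n → κ),
        (Finset.univ.filter fun i => (Fin.consEquiv fun _ : Fin (n + 1) => κ) (a, l) i = k).card =
          (if a = k then 1 else 0) + (Finset.univ.filter fun i => l i = k).card := by
      intro a l
      rw [Fin.card_filter_univ_succ]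
      simp only [Fin.consEquiv_apply, Fin.cons_zero, Fin.cons_succ]
      split_ifs <;> simp [add_comm]
    have hsum : ∀ a : κ, ∑ l : Fin n → κ, q ^ (n + 1) * (A + B * ((Finset.univ.filter fun i =>
          (Fin.consEquiv fun _ : Fin (n + 1) => κ) (a, l) i = k).card : ℝ) +
        C * ((Finset.univ.filter fun i =>
          (Fin.consEquiv fun _ : Fin (n + 1) => κ) (a, l) i = k).card : ℝ) ^ 2) =
        q * (A + B * (n * q) + C * (n * q + n * (n - 1) * q ^ 2)) +
          if a = k then q * (B + C + 2 * C * (n * q)) else 0 := by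
      intro a
      simp_rw [hcard]
      by_cases ha : a = k
      · simp only [if_pos ha]
        -- A first ball in box `k` replaces the count N by N + 1, which changes the coefficients of
        -- the quadratic; hence the induction over general `A B C`.
        have := ih (A + B + C) (B + 2 * C) C
        calc _ = q * ∑ l : Fin n → κ, q ^ n * ((A + B + C) +
              (B + 2 * C) * ((Finset.univ.filter fun i => l i = k).card : ℝ) +
              C * ((Finset.univ.filter fun i => l i = k).card : ℝ) ^ 2) := by
              rw [Finset.mul_sum]
              refine Finset.sum_congr rfl fun l _ => ?_
              push_cast; ring
          _ = _ := by rw [this]; ring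
      · simp only [if_neg ha]
        rw [add_zero, ← ih A B C, Finset.mul_sum]
        refine Finset.sum_congr rfl fun l _ => ?_
        push_cast; ring
    rw [Finset.sum_congr rfl fun a _ => hsum a, Finset.sum_add_distrib, Finset.sum_ite_eq']
    simp only [Finset.mem_univ, if_true, Finset.sum_const, Finset.card_univ, nsmul_eq_mul]
    rw [← mul_assoc, hq]
    push_cast; ring

/-- The variance nq(1 - q) is at most nq. -/
theorem sum_occupancy_le {q : ℝ} (hq : Fintype.card κ * q = 1) (k : κ) (n : ℕ)
    {A B : ℝ} (hB : 0 ≤ B) :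
    ∑ l : Fin n → κ, q ^ n *
      (A + B * (((Finset.univ.filter fun i => l i = k).card : ℝ) - n * q) ^ 2) ≤
      A + B * (n * q) := by
  have h := sum_occupancy_quadratic hq k n (A + B * (n * q) ^ 2) (-2 * B * (n * q)) B
  have : ∀ l : Fin n → κ, q ^ n *
      (A + B * (((Finset.univ.filter fun i => l i = k).card : ℝ) - n * q) ^ 2) =
      q ^ n * (A + B * (n * q) ^ 2 +
        -2 * B * (n * q) * ((Finset.univ.filter fun i => l i = k).card : ℝ) +
        B * ((Finset.univ.filter fun i => l i = k).card : ℝ) ^ 2) := fun l => by ring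
  rw [Finset.sum_congr rfl fun l _ => this l, h]
  have : 0 ≤ B * (n * q ^ 2) := by positivity
  nlinarith

end Occupancy

/-! ### Upper bound of order n^(1-α/2). -/

section UpperBound

variable {h : Plane → Plane → ℝ} {c₁ c₂ h₀ α : ℝ}

theorem IsEdgeWeight.meanTsp_le_of_quadratic (H : IsEdgeWeight h c₁ c₂ h₀) (hα₀ : 0 < α)
    (hα₂ : α < 2) {n m : ℕ} (hm : 1 ≤ m) {A B : ℝ} (hB : 0 ≤ B)
    (hT : ∀ j : ℕ, meanTsp h α j ≤ A + B * ((j : ℝ) - n * ((m : ℝ) ^ 2)⁻¹) ^ 2) :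
    meanTsp h α n ≤ (m : ℝ) ^ (2 - α) * (h₀ ^ α * (A + B * (n * ((m : ℝ) ^ 2)⁻¹)) +
      24 * 2 ^ α / (4 - 2 ^ α) * (2 * c₂) ^ α) := by
  have hm' : (0 : ℝ) < m := by positivity
  have hh := H.h₀_pos
  have hq : (Fintype.card (Fin m × Fin m) : ℝ) * ((m : ℝ) ^ 2)⁻¹ = 1 := by
    rw [Fintype.card_prod, Fintype.card_fin]; push_cast; field_simp
  refine (H.meanTsp_le_cells hα₀ hα₂ n hm).trans ?_
  have h1 : ∑ Q : Fin m × Fin m, ∑ l : Fin n → Fin m × Fin m,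
        (((m : ℝ) ^ 2)⁻¹) ^ n * meanTsp h α (cellNodes l Q).card ≤
      (m : ℝ) ^ 2 * (A + B * (n * ((m : ℝ) ^ 2)⁻¹)) := by
    calc _ ≤ ∑ Q : Fin m × Fin m, (A + B * (n * ((m : ℝ) ^ 2)⁻¹)) := by
          refine Finset.sum_le_sum fun Q _ => le_trans ?_ (sum_occupancy_le hq Q n hB)
          exact Finset.sum_le_sum fun l _ => mul_le_mul_of_nonneg_left (hT _) (by positivity)
      _ = _ := by
          rw [Finset.sum_const, Finset.card_univ, nsmul_eq_mul, Fintype.card_prod,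
            Fintype.card_fin]
          push_cast; ring
  have h2 := mul_le_mul_of_nonneg_left h1 (by positivity : 0 ≤ (h₀ / m) ^ α)
  have e : (h₀ / m) ^ α * ((m : ℝ) ^ 2 * (A + B * (n * ((m : ℝ) ^ 2)⁻¹))) =
      (m : ℝ) ^ (2 - α) * (h₀ ^ α * (A + B * (n * ((m : ℝ) ^ 2)⁻¹))) := by
    rw [Real.div_rpow hh.le hm'.le, Real.rpow_sub hm', Real.rpow_two]; ring
  rw [e] at h2
  linarith

theorem cellJoin_const_nonneg (hα₂ : α < 2) (hc₂ : 0 < c₂) :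
    0 ≤ 24 * 2 ^ α / (4 - 2 ^ α) * (2 * c₂) ^ α := by
  have : (2 : ℝ) ^ α < (2 : ℝ) ^ (2 : ℝ) := Real.rpow_lt_rpow_of_exponent_lt (by norm_num) hα₂
  norm_num at this
  have h4 : 0 < 4 - (2 : ℝ) ^ α := by linarith
  positivity

/-- With m of order √n a cell holds at most one node on average, and the trivial linear bound on the
mean weight is good enough there. -/
theorem IsEdgeWeight.exists_meanTsp_le (H : IsEdgeWeight h c₁ c₂ h₀) (hα₀ : 0 < α)
    (hα₂ : α < 2) : ∃ C : ℝ, 0 ≤ C ∧ ∀ n : ℕ, meanTsp h α n ≤ C * (n : ℝ) ^ (1 - α / 2) := by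
  have hh := H.h₀_pos
  have hc₂ := H.c₂_pos
  set K := 24 * 2 ^ α / (4 - 2 ^ α) * (2 * c₂) ^ α with hKdef
  have hK : 0 ≤ K := cellJoin_const_nonneg hα₂ hc₂
  set c := (2 * c₂) ^ α with hc
  have hc0 : 0 ≤ c := by positivity
  refine ⟨4 * (h₀ ^ α * (3 * c) + K), by positivity, fun n => ?_⟩
  -- For `n = 0` the choice of `m` below would give an empty grid.
  rcases Nat.eq_zero_or_pos n with rfl | hn
  · have := H.meanTsp_le_mul hα₀ 0
    rw [Nat.cast_zero, zero_mul] at this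
    exact this.trans (by positivity)
  have hn' : (1 : ℝ) ≤ n := by exact_mod_cast hn
  have hs : 1 ≤ √(n : ℝ) := Real.one_le_sqrt.2 hn'
  set m := ⌈√(n : ℝ)⌉₊ with hmdef
  have hm1 : √(n : ℝ) ≤ m := Nat.le_ceil _
  have hm2 : (m : ℝ) ≤ 2 * √(n : ℝ) := by
    have := Nat.ceil_lt_add_one (Real.sqrt_nonneg (n : ℝ)); linarith
  have hm : 1 ≤ m := by exact_mod_cast hs.trans hm1
  have hmp : (0 : ℝ) < m := by positivity
  have hμ : (n : ℝ) * ((m : ℝ) ^ 2)⁻¹ ≤ 1 := by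
    rw [← div_eq_mul_inv, div_le_one (by positivity), ← Real.sq_sqrt (by positivity : (0 : ℝ) ≤ n)]
    gcongr
  have hμ0 : 0 ≤ (n : ℝ) * ((m : ℝ) ^ 2)⁻¹ := by positivity
  have key := H.meanTsp_le_of_quadratic hα₀ hα₂ hm (n := n) (A := 2 * c) (B := c) hc0 (fun j => by
    have h1 := H.meanTsp_le_mul hα₀ j
    rw [mul_comm] at h1
    refine h1.trans ?_
    rw [← hc]
    have : (j : ℝ) ≤ 2 + ((j : ℝ) - n * ((m : ℝ) ^ 2)⁻¹) ^ 2 := by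
      nlinarith [sq_nonneg ((j : ℝ) - n * ((m : ℝ) ^ 2)⁻¹ - 1)]
    nlinarith)
  refine key.trans ?_
  have h1 : (m : ℝ) ^ (2 - α) ≤ 4 * (n : ℝ) ^ (1 - α / 2) := by
    calc (m : ℝ) ^ (2 - α) ≤ (2 * √(n : ℝ)) ^ (2 - α) :=
          Real.rpow_le_rpow hmp.le hm2 (by linarith)
      _ = 2 ^ (2 - α) * (n : ℝ) ^ (1 - α / 2) := by
          rw [Real.mul_rpow (by norm_num) (by positivity), Real.sqrt_eq_rpow,
            ← Real.rpow_mul (by positivity)]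
          ring_nf
      _ ≤ 2 ^ (2 : ℝ) * (n : ℝ) ^ (1 - α / 2) := by
          gcongr
          · norm_num
          · linarith
      _ = _ := by norm_num
  have h2 : h₀ ^ α * (2 * c + c * (n * ((m : ℝ) ^ 2)⁻¹)) + K ≤ h₀ ^ α * (3 * c) + K := by
    have : 0 ≤ h₀ ^ α := by positivity
    nlinarith [mul_le_mul_of_nonneg_left hμ hc0]
  calc _ ≤ (4 * (n : ℝ) ^ (1 - α / 2)) * (h₀ ^ α * (3 * c) + K) := by
        apply mul_le_mul h1 h2 (by positivity) (by positivity)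
    _ = _ := by ring

end UpperBound

/-! ### Comparison of the scaled means and passage to the limit. -/

section Asymptotics

open Filter Topology

/-- A quadratic majorant, centred at `μ`, of a subadditive function of order `n ^ β`. -/
theorem le_quadratic_of_subadditive {T : ℕ → ℝ} {β C : ℝ} (hβ0 : 0 < β) (hβ1 : β < 1) (hC : 0 ≤ C)
    (hT0 : ∀ n, 0 ≤ T n) (hT : ∀ n : ℕ, T n ≤ C * (n : ℝ) ^ β)
    (hadd : ∀ a b, T (a + b) ≤ T a + T b + C)
    {a : ℕ} {y μ : ℝ} (hy : 0 < y) (hya : y ≤ a) (hμ1 : a + y ≤ μ) (hμ2 : μ ≤ a + 2 * y) (j : ℕ) :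
    T j ≤ (T a + C + 4 * C * y ^ β) + 2 * C * ((a : ℝ) ^ β / y ^ 2) * ((j : ℝ) - μ) ^ 2 := by
  have hyβ : 0 ≤ y ^ β := by positivity
  have haβ : 0 ≤ (a : ℝ) ^ β := by positivity
  -- Below `a` the distance to `μ` is at least `y`, so the quadratic term alone absorbs `C * a ^ β`.
  -- From `a` on, subadditivity compares with `T a`; monotonicity of `T` is not used, which is why
  -- `μ` is centred above `a`.
  rcases lt_or_ge j a with hj | hj
  · have hj' : (j : ℝ) ≤ a := by exact_mod_cast hj.le
    have h1 : T j ≤ C * (a : ℝ) ^ β := (hT j).trans (by gcongr)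
    have h2 : 1 ≤ ((j : ℝ) - μ) ^ 2 / y ^ 2 := by
      rw [one_le_div (by positivity)]; nlinarith
    have h3 : C * (a : ℝ) ^ β ≤ 2 * C * ((a : ℝ) ^ β / y ^ 2) * ((j : ℝ) - μ) ^ 2 := by
      have e : 2 * C * ((a : ℝ) ^ β / y ^ 2) * ((j : ℝ) - μ) ^ 2 =
        2 * (C * (a : ℝ) ^ β) * (((j : ℝ) - μ) ^ 2 / y ^ 2) := by ring
      rw [e]
      have : 0 ≤ C * (a : ℝ) ^ β := by positivity
      nlinarith
    have := hT0 a
    have : 0 ≤ C * y ^ β := by positivity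
    linarith
  · obtain ⟨d, rfl⟩ := Nat.exists_eq_add_of_le hj
    have h1 := hadd a d
    have h2 := hT d
    -- Since μ - a ≤ 2y, an excess `d` above 4y forces j - μ ≥ d/2, and the quadratic term takes
    -- over.
    rcases le_or_gt (d : ℝ) (4 * y) with hd | hd
    · have h3 : (d : ℝ) ^ β ≤ 4 * y ^ β := by
        calc (d : ℝ) ^ β ≤ (4 * y) ^ β := by gcongr
          _ = 4 ^ β * y ^ β := Real.mul_rpow (by norm_num) hy.le
          _ ≤ 4 ^ (1 : ℝ) * y ^ β := by gcongr; norm_num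
          _ = _ := by rw [Real.rpow_one]
      have h4 : 0 ≤ 2 * C * ((a : ℝ) ^ β / y ^ 2) * (((a + d : ℕ) : ℝ) - μ) ^ 2 := by positivity
      have := mul_le_mul_of_nonneg_left h3 hC
      linarith
    · set z : ℝ := ((a + d : ℕ) : ℝ) - μ with hz
      have hz1 : (d : ℝ) ≤ 2 * z := by rw [hz]; push_cast; linarith
      have hzy : y ≤ z := by linarith
      have hz0 : 0 < z := by linarith
      have h3 : z ^ β ≤ (a : ℝ) ^ β / y ^ 2 * z ^ 2 := by
        have e : z ^ β = y ^ β * (z / y) ^ β := by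
          rw [← Real.mul_rpow hy.le (by positivity)]; congr 1; field_simp
        have h5 : (z / y) ^ β ≤ (z / y) ^ (2 : ℝ) :=
          Real.rpow_le_rpow_of_exponent_le (by rwa [one_le_div hy]) (by linarith)
        rw [Real.rpow_two] at h5
        rw [e]
        calc y ^ β * (z / y) ^ β ≤ (a : ℝ) ^ β * (z / y) ^ 2 := by gcongr
          _ = _ := by rw [div_pow]; ring
      have h4 : (d : ℝ) ^ β ≤ 2 * z ^ β := by
        calc (d : ℝ) ^ β ≤ (2 * z) ^ β := by gcongr
          _ = 2 ^ β * z ^ β := Real.mul_rpow (by norm_num) hz0.le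
          _ ≤ 2 ^ (1 : ℝ) * z ^ β := by gcongr; norm_num
          _ = _ := by rw [Real.rpow_one]
      have h6 : C * (d : ℝ) ^ β ≤ C * (2 * ((a : ℝ) ^ β / y ^ 2 * z ^ 2)) := by
        gcongr; linarith
      have : 0 ≤ C * y ^ β := by positivity
      linarith

/-- With m = ⌊√(n/s)⌋ the ratio n/m² is at least s and tends to s. -/
theorem eventually_exists_grid {s t : ℝ} (hs : 0 < s) (hst : s < t) :
    ∀ᶠ n : ℕ in atTop, ∃ m : ℕ, 1 ≤ m ∧ s ≤ n * ((m : ℝ) ^ 2)⁻¹ ∧ n * ((m : ℝ) ^ 2)⁻¹ ≤ t := by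
  have h1 : Tendsto (fun n : ℕ => √((n : ℝ) / s)) atTop atTop :=
    Real.tendsto_sqrt_atTop.comp (tendsto_natCast_atTop_atTop.atTop_div_const hs)
  have h2 : Tendsto (fun n : ℕ => ((⌊√((n : ℝ) / s)⌋₊ : ℝ) / √((n : ℝ) / s)) ^ 2) atTop
      (𝓝 (1 ^ 2)) := ((tendsto_nat_floor_div_atTop (R := ℝ)).comp h1).pow 2
  have h3 : s / t < 1 ^ 2 := by rw [one_pow, div_lt_one (hs.trans hst)]; exact hst
  filter_upwards [h2.eventually (lt_mem_nhds h3), h1.eventually_ge_atTop 1] with n hn hn1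
  have hpos : 0 < √((n : ℝ) / s) := by linarith
  have hm : 1 ≤ ⌊√((n : ℝ) / s)⌋₊ := by rwa [Nat.one_le_floor_iff]
  have hm' : (0 : ℝ) < (⌊√((n : ℝ) / s)⌋₊ : ℝ) := by exact_mod_cast hm
  have hfl := Nat.floor_le hpos.le
  have hsq : √((n : ℝ) / s) ^ 2 = n / s := Real.sq_sqrt (by positivity)
  refine ⟨_, hm, ?_, ?_⟩
  · rw [← div_eq_mul_inv, le_div_iff₀ (by positivity)]
    have : ((⌊√((n : ℝ) / s)⌋₊ : ℝ)) ^ 2 ≤ n / s :=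
      (pow_le_pow_left₀ hm'.le hfl 2).trans_eq hsq
    rw [le_div_iff₀ hs] at this
    linarith
  · rw [← div_eq_mul_inv, div_le_iff₀ (by positivity)]
    rw [div_pow, hsq, div_lt_div_iff₀ (hs.trans hst)
      (by rw [← hsq]; positivity)] at hn
    rw [mul_div_cancel₀ _ hs.ne'] at hn
    linarith

/-- The error term in the comparison of the scaled means. -/
theorem eventually_scaled_le {T : ℕ → ℝ} {β C G K : ℝ} (hβ0 : 0 < β) (hβ1 : β < 1) (hC : 0 ≤ C)
    (hG : 0 ≤ G) (hK : 0 ≤ K)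
    (hT0 : ∀ n, 0 ≤ T n) (hT : ∀ n : ℕ, T n ≤ C * (n : ℝ) ^ β)
    (hadd : ∀ a b, T (a + b) ≤ T a + T b + C)
    (hquad : ∀ n m : ℕ, 1 ≤ m → ∀ A B : ℝ, 0 ≤ B →
      (∀ j : ℕ, T j ≤ A + B * ((j : ℝ) - n * ((m : ℝ) ^ 2)⁻¹) ^ 2) →
      T n ≤ (m : ℝ) ^ (2 * β) * (G * (A + B * (n * ((m : ℝ) ^ 2)⁻¹)) + K))
    {a : ℕ} (ha : 1 ≤ a) :
    ∀ᶠ n : ℕ in atTop, T n / (n : ℝ) ^ β ≤ G * (T a / (a : ℝ) ^ β) +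
      ((G * C + K) * (a : ℝ) ^ (-β) + 4 * G * C * (a : ℝ) ^ (-(β / 4)) +
        6 * G * C * (a : ℝ) ^ (-(1 / 2 : ℝ))) := by
  have ha1 : (1 : ℝ) ≤ a := by exact_mod_cast ha
  have ha0 : (0 : ℝ) < a := by linarith
  -- Any exponent strictly between 1/2 and 1 would do: y ≪ a makes y^β negligible against a^β, and y
  -- ≫ √a makes the variance term, of order a^β · a/y², negligible too.
  set y : ℝ := (a : ℝ) ^ (3 / 4 : ℝ) with hy
  have hy0 : 0 < y := by positivity
  have hya : y ≤ a := by
    calc y ≤ (a : ℝ) ^ (1 : ℝ) := Real.rpow_le_rpow_of_exponent_le ha1 (by norm_num)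
      _ = a := Real.rpow_one _
  filter_upwards [eventually_exists_grid (s := a + y) (t := a + 2 * y) (by linarith) (by linarith)]
    with n hn
  obtain ⟨m, hm, hμ1, hμ2⟩ := hn
  set μ : ℝ := n * ((m : ℝ) ^ 2)⁻¹ with hμ
  have hm0 : (0 : ℝ) < m := by positivity
  have hμ0 : 0 < μ := by linarith
  have hnμ : (n : ℝ) = (m : ℝ) ^ 2 * μ := by rw [hμ]; field_simp
  have hTa := hT0 a
  have key := hquad n m hm _ _ (by positivity)
    (fun j => le_quadratic_of_subadditive hβ0 hβ1 hC hT0 hT hadd hy0 hya hμ1 hμ2 j)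
  have hnβ : (n : ℝ) ^ β = (m : ℝ) ^ (2 * β) * μ ^ β := by
    rw [hnμ, Real.mul_rpow (by positivity) hμ0.le, Real.rpow_mul hm0.le, Real.rpow_two]
  have hle : (m : ℝ) ^ (2 * β) * (a : ℝ) ^ β ≤ (n : ℝ) ^ β := by
    rw [hnβ]; gcongr; linarith
  have hμ3 : μ ≤ 3 * a := by linarith
  set R : ℝ := G * ((T a + C + 4 * C * y ^ β) + 2 * C * ((a : ℝ) ^ β / y ^ 2) * (3 * a)) + K
    with hR
  have hR0 : 0 ≤ R := by positivity
  have key2 : T n ≤ (m : ℝ) ^ (2 * β) * R := by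
    refine key.trans ?_
    rw [hR]; gcongr
  have h1 : T n / (n : ℝ) ^ β ≤ R / (a : ℝ) ^ β := by
    calc T n / (n : ℝ) ^ β ≤ ((m : ℝ) ^ (2 * β) * R) / ((m : ℝ) ^ (2 * β) * (a : ℝ) ^ β) :=
          div_le_div₀ (by positivity) key2 (by positivity) hle
      _ = _ := by rw [mul_div_mul_left _ _ (by positivity)]
  refine h1.trans (le_of_eq ?_)
  have e1 : y ^ β = (a : ℝ) ^ β * (a : ℝ) ^ (-(β / 4)) := by
    rw [hy, ← Real.rpow_mul ha0.le, ← Real.rpow_add ha0]; ring_nf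
  have e2 : (a : ℝ) / y ^ 2 = (a : ℝ) ^ (-(1 / 2 : ℝ)) := by
    rw [hy, ← Real.rpow_natCast, ← Real.rpow_mul ha0.le]
    nth_rewrite 1 [← Real.rpow_one (a : ℝ)]
    rw [← Real.rpow_sub ha0]; norm_num
  have e3 : (a : ℝ) ^ (-β) = ((a : ℝ) ^ β)⁻¹ := Real.rpow_neg ha0.le _
  have hp : (a : ℝ) ^ β ≠ 0 := by positivity
  rw [hR, e1, ← e2, e3]
  field_simp
  ring

/-- In `hcmp`, n goes to infinity with `a` fixed; then `a` runs through indices where `t a` is close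
to the liminf. The bounds `c` and `C` make both limits finite, so the argument takes place in ℝ. -/
theorem limsup_le_mul_liminf {t e : ℕ → ℝ} {c C G : ℝ} (hc : 0 < c) (hG : 0 < G)
    (hlow : ∀ᶠ n in atTop, c ≤ t n) (hup : ∀ᶠ n in atTop, t n ≤ C)
    (he : Tendsto e atTop (𝓝 0))
    (hcmp : ∀ a : ℕ, 1 ≤ a → ∀ᶠ n in atTop, t n ≤ G * t a + e a) :
    0 < liminf (fun n => (t n : EReal)) atTop ∧
    liminf (fun n => (t n : EReal)) atTop ≤ limsup (fun n => (t n : EReal)) atTop ∧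
    limsup (fun n => (t n : EReal)) atTop ≤ (G : EReal) * liminf (fun n => (t n : EReal)) atTop ∧
    (G : EReal) * liminf (fun n => (t n : EReal)) atTop < ⊤ := by
  have h1 : (c : EReal) ≤ liminf (fun n => (t n : EReal)) atTop :=
    le_liminf_of_le (by isBoundedDefault) (hlow.mono fun n hn => by exact_mod_cast hn)
  have h2 : limsup (fun n => (t n : EReal)) atTop ≤ (C : EReal) :=
    limsup_le_of_le (by isBoundedDefault) (hup.mono fun n hn => by exact_mod_cast hn)
  have h3 : liminf (fun n => (t n : EReal)) atTop ≤ limsup (fun n => (t n : EReal)) atTop :=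
    liminf_le_limsup
  obtain ⟨L, hL⟩ : ∃ L : ℝ, liminf (fun n => (t n : EReal)) atTop = (L : EReal) := by
    refine ⟨_, (EReal.coe_toReal ?_ ?_).symm⟩
    · exact ((h3.trans h2).trans_lt (EReal.coe_lt_top C)).ne
    · exact ((EReal.bot_lt_coe c).trans_le h1).ne'
  obtain ⟨U, hU⟩ : ∃ U : ℝ, limsup (fun n => (t n : EReal)) atTop = (U : EReal) := by
    refine ⟨_, (EReal.coe_toReal ?_ ?_).symm⟩
    · exact (h2.trans_lt (EReal.coe_lt_top C)).ne
    · exact ((EReal.bot_lt_coe c).trans_le (h1.trans h3)).ne'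
  refine ⟨lt_of_lt_of_le (by exact_mod_cast hc) h1, h3, ?_, ?_⟩
  · rw [hU, hL, ← EReal.coe_mul, EReal.coe_le_coe_iff]
    refine le_of_forall_pos_le_add fun ε hε => ?_
    set δ : ℝ := ε / (G + 1) with hδ
    have hδ0 : 0 < δ := by positivity
    have hfreq : ∃ᶠ a in atTop, (t a : EReal) < ((L + δ : ℝ) : EReal) := by
      refine frequently_lt_of_liminf_lt (by isBoundedDefault) ?_
      rw [hL, EReal.coe_lt_coe_iff]; linarith
    obtain ⟨a, ⟨ha1, ha2⟩, ha3⟩ := (hfreq.and_eventually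
      (he.eventually (gt_mem_nhds hδ0))).and_eventually (eventually_ge_atTop 1) |>.exists
    have ha1' : t a < L + δ := by exact_mod_cast ha1
    have h4 : limsup (fun n => (t n : EReal)) atTop ≤ ((G * t a + e a : ℝ) : EReal) :=
      limsup_le_of_le (by isBoundedDefault)
        ((hcmp a ha3).mono fun n hn => by exact_mod_cast hn)
    rw [hU, EReal.coe_le_coe_iff] at h4
    have e1 : G * (L + δ) + δ = G * L + ε := by rw [hδ]; field_simp; ring
    have := mul_le_mul_of_nonneg_left ha1'.le hG.le
    linarith
  · rw [hL, ← EReal.coe_mul]; exact EReal.coe_lt_top _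

end Asymptotics

theorem theorem5 {Ω : Type*} [MeasurableSpace Ω] (P : MeasureTheory.Measure Ω)
    [MeasureTheory.IsProbabilityMeasure P]
    -- the nodes: independent and uniformly distributed in the unit square
    (X : ℕ → Ω → Plane)
    (hX_meas : ∀ i, Measurable (X i))
    (hX_indep : ProbabilityTheory.iIndepFun X P)
    (hX_unif : ∀ i, MeasureTheory.pdf.IsUniform (X i) unitSquare P MeasureTheory.volume)
    -- the edge weight function
    (h : Plane → Plane → ℝ)
    (h_meas : Measurable (Function.uncurry h))
    (c₁ c₂ : ℝ) (hc₁ : 0 < c₁) (hc₂ : 0 < c₂)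
    (h_equiv : ∀ x ∈ unitSquare, ∀ y ∈ unitSquare,
      c₁ * dist x y ≤ h x y ∧ h x y = h y x ∧ h x y ≤ c₂ * dist x y)
    (h_scale : ∀ a : ℝ, 0 < a → ∀ u v : Plane, h (a • u) (a • v) = a * h u v)
    (h₀ : ℝ) (h₀_pos : 0 < h₀)
    (h_trans : ∀ b u v : Plane, h (b + u) (b + v) ≤ h₀ * h u v)
    -- the edge weight exponent
    (α : ℝ) (hα₀ : 0 < α) (hα₂ : α < 2) :
    (∀ n, MeasureTheory.Integrable (tspOf h α X n) P) ∧
    0 < Filter.liminf (scaledMeanTSP P h α X) Filter.atTop ∧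
    Filter.liminf (scaledMeanTSP P h α X) Filter.atTop
      ≤ Filter.limsup (scaledMeanTSP P h α X) Filter.atTop ∧
    Filter.limsup (scaledMeanTSP P h α X) Filter.atTop
      ≤ ((h₀ ^ α : ℝ) : EReal) * Filter.liminf (scaledMeanTSP P h α X) Filter.atTop ∧
    ((h₀ ^ α : ℝ) : EReal) * Filter.liminf (scaledMeanTSP P h α X) Filter.atTop < ⊤ := by
  have H : IsEdgeWeight h c₁ c₂ h₀ := ⟨h_meas, hc₁, hc₂, h_equiv, h_scale, h₀_pos, h_trans⟩
  have hlaw : ∀ i, P.map (X i) = unifSquare := fun i => by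
    rw [hX_unif i, ProbabilityTheory.cond, volume_unitSquare, inv_one, one_smul]; rfl
  have hT := fun n => H.tspOf_integrable_and_integral hα₀ hX_meas hX_indep hlaw n
  have hscaled : scaledMeanTSP P h α X =
      fun n => ((meanTsp h α n / (n : ℝ) ^ (1 - α / 2) : ℝ) : EReal) := by
    ext1 n; rw [scaledMeanTSP, (hT n).2]
  refine ⟨fun n => (hT n).1, ?_⟩
  rw [hscaled]
  obtain ⟨C, hC, hup⟩ := H.exists_meanTsp_le hα₀ hα₂
  -- One constant serves both as growth bound and as additive error in subadditivity.
  set C' : ℝ := max C (2 * (2 * c₂) ^ α)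
  have hβ0 : 0 < 1 - α / 2 := by linarith
  have hup' : ∀ n : ℕ, meanTsp h α n ≤ C' * (n : ℝ) ^ (1 - α / 2) := fun n =>
    (hup n).trans (by gcongr; exact le_max_left _ _)
  have hK := cellJoin_const_nonneg hα₂ hc₂
  have hG : 0 < h₀ ^ α := by positivity
  refine limsup_le_mul_liminf (c := c₁ ^ α * 8 ^ (-(α / 2)) / 2) (C := C') (by positivity) hG
    ?_ ?_ ?_ (fun a ha => eventually_scaled_le hβ0 (by linarith) (hC.trans (le_max_left _ _))
      hG.le hK H.meanTsp_nonneg hup' (fun a b => (H.meanTsp_add_le hα₀ a b).trans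
        (by gcongr; exact le_max_right _ _)) (fun n m hm A B hB hj => ?_) ha)
  · filter_upwards [Filter.eventually_ge_atTop 2] with n hn
    rw [le_div_iff₀ (by positivity)]
    exact H.le_meanTsp hα₀ hn
  · filter_upwards [Filter.eventually_ge_atTop 2] with n hn
    rw [div_le_iff₀ (by positivity)]
    exact hup' n
  · have key : ∀ s : ℝ, 0 < s → Filter.Tendsto (fun a : ℕ => (a : ℝ) ^ (-s)) Filter.atTop
        (nhds 0) := fun s hs => (tendsto_rpow_neg_atTop hs).comp tendsto_natCast_atTop_atTop
    have := (((key _ hβ0).const_mul (h₀ ^ α * C' + 24 * 2 ^ α / (4 - 2 ^ α) * (2 * c₂) ^ α)).add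
      ((key ((1 - α / 2) / 4) (by linarith)).const_mul (4 * h₀ ^ α * C'))).add
      ((key (1 / 2) (by norm_num)).const_mul (6 * h₀ ^ α * C'))
    simpa using this
  · have e : 2 * (1 - α / 2) = 2 - α := by ring
    rw [e]
    exact H.meanTsp_le_of_quadratic hα₀ hα₂ hm hB hj
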